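/- For $n\ge 1$ let $t=4n$, let $[t]=\{1,\dots,t\}$, and for $x,y\in[t]^n$ let $\mathrm{EE}_n(x,y)=1$ if $x_i=y_i$ for some $i$, and $\mathrm{EE}_n(x,y)=0$ otherwise. Let $\nu_n$ be the uniform distribution on $[t]^n\times[t]^n$. Logarithms are to base $2$; $\log^{(0)}x=x$, $\log^{(r)}x=\log(\log^{(r-1)}x)$ for $r\ge1$, and $\log^* x$ is the smallest integer $r\ge 0$ with $\log^{(r)}x<2$. In a deterministic $r$-round protocol for $\mathrm{EE}_n$, Alice holds $x$, Bob holds $y$, and the players (either of whom may start) take at most $r$ turns alternately sending each other a message, a finite bit string that depends on the sender's input and the previous messages; the last player to receive a message (with no message, the player whose turn is first) then declares an output bit that depends on this player's input and the messages. Its error on $\nu_n$ is the probability, for $(x,y)\sim\nu_n$, that the output differs from $\mathrm{EE}_n(x,y)$. Theorem. There are constants $\varepsilon_0>0$ and $\gamma>0$ such that for every integer $n\ge1$ and every integer $0\le r\le\log^* n$, every $r$-round deterministic protocol for $\mathrm{EE}_n$ whose error on $\nu_n$ is at most $\varepsilon_0$ sends, on some pair of inputs, at least one message of at least $\gamma\,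 n\log^{(r)}n$ bits. -/

import Mathlib

namespace ExistsEqual

/-- The iterated base-2 logarithm `log^(r) x`. -/
noncomputable def logIter : ℕ → ℝ → ℝ
  | 0, x => x
  | r + 1, x => Real.logb 2 (logIter r x)

/-- Every sequence of iterated logarithms gets below `2`. -/
theorem exists_logIter_lt_two (x : ℝ) : ∃ r, logIter r x < 2 := by
  by_contra! h
  have key : ∀ r : ℕ, logIter r x ≤ x - r * (1 / 8) := by
    intro r
    induction r with
    | zero => simp [logIter]
    | succ r ih =>
      have h2 := h r
      have hlog2 := Real.log_two_gt_d9
      have hlt := Real.log_two_lt_d9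
      have step : logIter (r + 1) x ≤ logIter r x - 1 / 8 := by
        show Real.logb 2 (logIter r x) ≤ _
        have h1 : Real.log (logIter r x / 2) ≤ logIter r x / 2 - 1 :=
          Real.log_le_sub_one_of_pos (by linarith)
        rw [Real.log_div (by linarith) (by norm_num)] at h1
        rw [Real.logb, div_le_iff₀ (by linarith)]
        nlinarith
      push_cast
      linarith
  obtain ⟨m, hm⟩ := exists_nat_gt (8 * x)
  have := key m
  have := h m
  linarith

/-- `log* x`: the smallest `r` with `log^(r) x < 2`. -/
noncomputable def logStar (x : ℝ) : ℕ :=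
  sInf {r : ℕ | logIter r x < 2}

/-- The input set `[t]^n` of each player. -/
abbrev Vec (t n : ℕ) : Type := Fin n → Fin t

/-- The exists-equal function: `true` iff the vectors agree in some coordinate. -/
def EE {t n : ℕ} (x y : Vec t n) : Bool := decide (∃ i, x i = y i)

inductive Player where
  | alice
  | bob

/-- A deterministic two-player protocol in which both players have inputs from `X`, seen from the
player whose turn it is. That player, knowing the own input and the messages exchanged so far,
either declares the output, or sends a bit string to the other player, whose turn it then is. -/
inductive Protocol (X : Type) : Type where
  | output (f : X → Bool) : Protocol X
  | send (msg : X → List Bool) (next : List Bool → Protocol X) : Protocol X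

namespace Protocol

variable {X : Type}

/-- The declared output, where `a` is the input of the player whose turn it is and `b` is the input
of the other player. -/
def run : Protocol X → X → X → Bool
  | output f, a, _ => f a
  | send msg next, a, b => run (next (msg a)) b a

/-- The list of messages sent, with `a` and `b` as in `run`. -/
def messages : Protocol X → X → X → List (List Bool)
  | output _, _, _ => []
  | send msg next, a, b => msg a :: messages (next (msg a)) b a

/-- The output of the protocol when `first` has the first turn, Alice has `x` and Bob has `y`. -/
def eval (P : Protocol X) (first : Player) (x y : X) : Bool :=
  match first with
  | .alice => P.run x y
  | .bob => P.run y x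

/-- The messages sent, in order, when `first` has the first turn, Alice has `x` and Bob has `y`. -/
def transcript (P : Protocol X) (first : Player) (x y : X) : List (List Bool) :=
  match first with
  | .alice => P.messages x y
  | .bob => P.messages y x

/-- An `r`-round protocol: the players never take more than `r` turns sending messages. -/
def IsRound (P : Protocol X) (first : Player) (r : ℕ) : Prop :=
  ∀ x y, (P.transcript first x y).length ≤ r

/-- Some message sent by the protocol, on some pair of inputs, has at least `s` bits. -/
def SendsMessageOfSize (P : Protocol X) (first : Player) (s : ℝ) : Prop :=
  ∃ x y, ∃ m ∈ P.transcript first x y, s ≤ (m.length : ℝ)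

end Protocol

/-- `ν_n`: the uniform distribution on `[t]^n × [t]^n` with `t = 4n`. -/
noncomputable def nu (n : ℕ) : MeasureTheory.Measure (Vec (4 * n) n × Vec (4 * n) n) :=
  ProbabilityTheory.uniformOn Set.univ

/-- The distributional error on `ν_n` of a protocol for `EE_n`. -/
noncomputable def distError {n : ℕ} (P : Protocol (Vec (4 * n) n)) (first : Player) : ℝ :=
  (nu n).real {p | P.eval first p.1 p.2 ≠ EE p.1 p.2}

end ExistsEqual

open Finset
open scoped BigOperators

set_option linter.unusedSectionVars false

namespace ExistsEqual

/-! ### Averages over finite types and products -/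

section Expect

variable {α β ι : Type*} [Fintype α] [Fintype β] [Fintype ι]

/-! The proof is round elimination. Cut the `m * ℓ` coordinates into `m` blocks of length `ℓ`, fix a
first message, and let `S` be the set of the sender's inputs that produce it. An instance `(u, v)`
with `m` coordinates over an alphabet of size `t' ≈ t / ℓ` is embedded as follows: the receiver uses
the words `g i (v i)` of a fixed table `g`, and the sender uses some `X u ∈ S` whose block `i`
should agree somewhere with `g i (u i)` and nowhere with the other words `g i w`. Equality of
letters becomes agreement of words, the first message is constant, and a round is gone
(`exists_round_elimination`).

A good table comes from planting. Draw `x ∈ S` and `u` uniformly, let `g i w` avoid `x i` for `w ≠ u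
i`, and let `g i (u i)` agree with `x i` in at most one random position. As `ℓ * t' ≈ t`, each word
that the receiver reads is nearly uniform (`readDens_le`). The law of `(u, g)` need not be close to
uniform in total variation, but its relative entropy is only `O(η m)` once `S` is not too small. In
one block this is a second moment estimate (`relEnt_mixture_le`), valid if planting avoids positions
whose letter has density above `K`; few positions are that heavy (`expect_card_heavy_le`). The chain
rule passes to `m` blocks (`exists_labelling_of_block`). So little entropy suffices: the least cost
over `S`, as a function of `u`, changes by at most `2 / t' = O(1 / m)` per coordinate, and bounded
differences with the Donsker–Varadhan inequality show that its mean over uniform `u` exceeds its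
planted mean by only `O(√η)` (`exists_embedding`).

One elimination with `k`-bit messages needs `K ≤ η ℓ` and `1 + k / (m * ℓ) ≤ η * log K`. For `k ≈ γ
n log^(r) n` and `T i = log^(r-i) n`, take `log (K i) ≈ T i / 8` and `η i` proportional to `4^(-i)`.
Then `ℓ 0 ⋯ ℓ (i-1)` is `O(T i / (4^i * T 0))`, which is consistent because `T (i+1) = 2 ^ T i`
(`exists_parameters`), and the losses `√(η i)` are summable. When no message is left, one player
must guess and errs with probability at least `1 / 11` (`unifError_guess_ge`). -/

theorem expect_pi_prod [DecidableEq ι] (f : ι → α → ℝ) :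
    𝔼 x : ι → α, ∏ i, f i (x i) = ∏ i, 𝔼 a, f i a := by
  simp only [Fintype.expect_eq_sum_div_card, prod_div_distrib, prod_univ_sum,
    Fintype.piFinset_univ]
  simp

theorem expect_fin_cons {m : ℕ} (f : (Fin (m + 1) → α) → ℝ) :
    𝔼 x, f x = 𝔼 a, 𝔼 xs : Fin m → α, f (Fin.cons a xs) := by
  rw [← expect_product', univ_product_univ]
  exact (Fintype.expect_equiv (Fin.consEquiv fun _ : Fin (m + 1) => α) _ _ (fun _ => rfl)).symm

theorem expect_mono {f g : α → ℝ} (h : ∀ a, f a ≤ g a) : 𝔼 a, f a ≤ 𝔼 a, g a :=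
  expect_le_expect fun a _ => h a

theorem expect_nonneg' {f : α → ℝ} (h : ∀ a, 0 ≤ f a) : 0 ≤ 𝔼 a, f a :=
  expect_nonneg fun a _ => h a

theorem expect_prod_type (f : α × β → ℝ) : 𝔼 p, f p = 𝔼 a, 𝔼 b, f (a, b) := by
  rw [← univ_product_univ, expect_product]

theorem expect_swap (f : α → β → ℝ) : 𝔼 a, 𝔼 b, f a b = 𝔼 b, 𝔼 a, f a b :=
  expect_comm _ _ _

/-- The marginal expectation of one coordinate under a product of densities. -/
theorem expect_pi_prod_mul [DecidableEq ι] (f : ι → α → ℝ) (hf : ∀ i, 𝔼 a, f i a = 1)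
    (i₀ : ι) (F : α → ℝ) :
    𝔼 x : ι → α, (∏ i, f i (x i)) * F (x i₀) = 𝔼 a, f i₀ a * F a := by
  have h := expect_pi_prod fun i a => f i a * (if i = i₀ then F a else 1)
  simp only [prod_mul_distrib, prod_ite_eq', mem_univ, if_true] at h
  rw [h, prod_eq_single i₀]
  · simp
  · intro i _ hi
    simp [hi, hf]
  · simp

end Expect

/-! ### Relative entropy of unnormalized densities -/

section RelEnt

variable {α β ι : Type*} [Fintype α] [Fintype β] [Fintype ι]

/-- Relative entropy, with respect to the uniform distribution, of a (not necessarily normalized)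
density. -/
noncomputable def relEnt (f : α → ℝ) : ℝ :=
  𝔼 a, f a * Real.log (f a) - (𝔼 a, f a) * Real.log (𝔼 a, f a)

/-- The bound `log z ≤ z - 1` at `z = F μ / (M f)`; with `μ` and `M` the total masses, the last two
terms cancel on averaging. -/
theorem gibbs_pointwise {f F μ M : ℝ} (hf : 0 ≤ f) (hF : 0 ≤ F) (h : F = 0 → f = 0)
    (hμ : 0 < μ) (hM : 0 < M) :
    f * Real.log F - f * Real.log M ≤ f * Real.log f - f * Real.log μ - f + μ * F / M := by
  rcases hf.eq_or_lt with rfl | hf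
  · simp only [zero_mul, sub_self, zero_add]
    positivity
  · have hF : 0 < F := lt_of_le_of_ne hF fun h0 => hf.ne' (h h0.symm)
    have h1 := Real.log_le_sub_one_of_pos (show 0 < F * μ / (M * f) by positivity)
    rw [Real.log_div (by positivity) (by positivity), Real.log_mul hF.ne' hμ.ne',
      Real.log_mul hM.ne' hf.ne'] at h1
    have h2 := mul_le_mul_of_nonneg_left h1 hf.le
    have h3 : f * (F * μ / (M * f) - 1) = μ * F / M - f := by
      field_simp
    linarith

/-- Gibbs' inequality. -/
theorem gibbs {f F : α → ℝ} (hf : ∀ a, 0 ≤ f a) (hF : ∀ a, 0 ≤ F a)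
    (h : ∀ a, F a = 0 → f a = 0) :
    𝔼 a, f a * Real.log (F a) - (𝔼 a, f a) * Real.log (𝔼 a, F a) ≤ relEnt f := by
  rcases (expect_nonneg' hf).eq_or_lt with h0 | hμ
  · have hf0 : f = 0 := (Fintype.expect_eq_zero_iff_of_nonneg hf).1 h0.symm
    simp [relEnt, hf0]
  have hM : 0 < 𝔼 a, F a := by
    refine (expect_nonneg' hF).lt_of_ne fun h0 => hμ.ne' ?_
    have hF0 : F = 0 := (Fintype.expect_eq_zero_iff_of_nonneg hF).1 h0.symm
    exact expect_eq_zero fun a _ => h a (by simp [hF0])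
  have key := expect_mono fun a => gibbs_pointwise (hf a) (hF a) (h a) hμ hM
  simp only [expect_add_distrib, expect_sub_distrib, ← expect_mul, ← mul_expect, ← expect_div]
    at key
  rw [mul_div_cancel_right₀ _ hM.ne'] at key
  unfold relEnt
  linarith

/-- Donsker–Varadhan inequality. -/
theorem expect_mul_le_relEnt {f Φ : α → ℝ} (hf : ∀ a, 0 ≤ f a) :
    𝔼 a, f a * Φ a ≤ relEnt f + (𝔼 a, f a) * Real.log (𝔼 a, Real.exp (Φ a)) := by
  have := gibbs (F := fun a => Real.exp (Φ a)) hf (fun a => (Real.exp_pos _).le)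
    (fun a h => absurd h (Real.exp_pos _).ne')
  simp only [Real.log_exp] at this
  linarith

/-- Convexity: Gibbs' inequality compares each `f i` with the average density. -/
theorem relEnt_expect_le {f : ι → α → ℝ} (hf : ∀ i a, 0 ≤ f i a) :
    relEnt (fun a => 𝔼 i, f i a) ≤ 𝔼 i, relEnt (f i) := by
  have h : ∀ i, 𝔼 a, f i a * Real.log (𝔼 i, f i a) -
      (𝔼 a, f i a) * Real.log (𝔼 a, 𝔼 i, f i a) ≤ relEnt (f i) := fun i => by
    refine gibbs (hf i) (fun a => expect_nonneg' fun i => hf i a) fun a h0 => ?_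
    have := (Fintype.expect_eq_zero_iff_of_nonneg (f := fun i => f i a) fun i => hf i a).1 h0
    exact congrFun this i
  refine le_trans (le_of_eq ?_) (expect_mono h)
  rw [expect_sub_distrib, expect_swap, ← expect_mul, expect_swap (fun i a => f i a)]
  simp only [relEnt, expect_mul]

/-- Homogeneity of degree one is what allows conditional densities to be used without normalizing
them. -/
theorem relEnt_mul {f : α → ℝ} {c : ℝ} : relEnt (fun a => c * f a) = c * relEnt f := by
  rcases eq_or_ne c 0 with rfl | hc
  · simp [relEnt]
  have h1 : ∀ x : ℝ, c * x * Real.log (c * x) = c * (x * Real.log x) + c * Real.log c * x := by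
    intro x
    rcases eq_or_ne x 0 with rfl | hx
    · simp
    · rw [Real.log_mul hc hx]; ring
  simp only [relEnt, ← mul_expect, h1, expect_add_distrib]
  ring

/-- The chain rule for relative entropy. -/
theorem relEnt_fin_cons {m : ℕ} (f : (Fin (m + 1) → α) → ℝ) :
    relEnt f = relEnt (fun a => 𝔼 xs : Fin m → α, f (Fin.cons a xs)) +
      𝔼 a, relEnt (fun xs : Fin m → α => f (Fin.cons a xs)) := by
  simp only [relEnt, expect_fin_cons f, expect_fin_cons fun x => f x * Real.log (f x),
    expect_sub_distrib]
  ring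

/-- By `log z ≤ z - 1`, relative entropy is at most the chi-square distance, so second moments
suffice. -/
theorem relEnt_le_sq {f : α → ℝ} (hf : ∀ a, 0 ≤ f a) (h1 : 𝔼 a, f a = 1) :
    relEnt f ≤ 𝔼 a, f a ^ 2 - 1 := by
  have : ∀ a, f a * Real.log (f a) ≤ f a ^ 2 - f a := fun a => by
    rcases (hf a).eq_or_lt with h | h
    · simp [← h]
    · nlinarith [Real.log_le_sub_one_of_pos h]
  have := expect_mono this
  rw [expect_sub_distrib, h1] at this
  simpa [relEnt, h1] using this

end RelEnt

/-! ### From one block to a sequence of blocks -/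

section Tensor

variable {Ω Γ B : Type*} [Fintype Ω] [Fintype Γ]

/-- If every density on one block has a labelling `β` with few bad positions whose mixture has small
relative entropy, then the same holds for densities on sequences of blocks. -/
theorem exists_labelling_of_block (κ : B → Ω → Γ → ℝ) (hκ : ∀ b x a, 0 ≤ κ b x a)
    (hκ1 : ∀ b x, 𝔼 a, κ b x a = 1) (bad : B → ℝ) (c₁ c₂ c₃ c₄ : ℝ)
    (hblock : ∀ ρ : Ω → ℝ, (∀ x, 0 ≤ ρ x) → ∃ β : Ω → B,
      𝔼 x, ρ x * bad (β x) ≤ c₁ * relEnt ρ + c₂ * 𝔼 x, ρ x ∧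
      relEnt (fun a => 𝔼 x, ρ x * κ (β x) x a) ≤ c₃ * relEnt ρ + c₄ * 𝔼 x, ρ x) :
    ∀ (m : ℕ) (ρ : (Fin m → Ω) → ℝ), (∀ x, 0 ≤ ρ x) → ∃ β : (Fin m → Ω) → Fin m → B,
      𝔼 x, ρ x * ∑ i, bad (β x i) ≤ c₁ * relEnt ρ + c₂ * m * 𝔼 x, ρ x ∧
      relEnt (fun a : Fin m → Γ => 𝔼 x, ρ x * ∏ i, κ (β x i) (x i) (a i)) ≤
        c₃ * relEnt ρ + c₄ * m * 𝔼 x, ρ x := by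
  intro m
  induction m with
  | zero =>
    intro ρ hρ
    refine ⟨fun _ i => i.elim0, ?_, ?_⟩ <;> simp [relEnt]
  | succ m ih =>
    intro ρ hρ
    set ρ₁ : Ω → ℝ := fun x₀ => 𝔼 xs : Fin m → Ω, ρ (Fin.cons x₀ xs) with hρ₁
    obtain ⟨β₁, hb₁, he₁⟩ := hblock ρ₁ fun x₀ => expect_nonneg' fun xs => hρ _
    choose β₂ hb₂ he₂ using fun x₀ => ih (fun xs => ρ (Fin.cons x₀ xs)) fun xs => hρ _
    have hmass : 𝔼 x, ρ x = 𝔼 x₀, ρ₁ x₀ := expect_fin_cons ρ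
    have hcast : ((m + 1 : ℕ) : ℝ) = m + 1 := by push_cast; ring
    -- The first block is labelled according to its marginal `ρ₁`; the labels of the later blocks
    -- come from the conditional density and so depend on the first block.
    refine ⟨fun x => Fin.cons (β₁ (x 0)) (β₂ (x 0) (Fin.tail x)), ?_, ?_⟩
    · rw [expect_fin_cons]
      simp only [Fin.sum_univ_succ, Fin.cons_zero, Fin.cons_succ, Fin.tail_cons, mul_add,
        expect_add_distrib, ← expect_mul]
      have h2 := expect_mono hb₂
      rw [expect_add_distrib, ← mul_expect, ← mul_expect] at h2
      rw [relEnt_fin_cons ρ, hmass, hcast]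
      change 𝔼 x, ρ₁ x * bad (β₁ x) + _ ≤ _
      linarith
    · set Z : Ω → (Fin m → Γ) → ℝ := fun x₀ b =>
        𝔼 xs : Fin m → Ω, ρ (Fin.cons x₀ xs) * ∏ i, κ (β₂ x₀ xs i) (xs i) (b i) with hZ
      have hZ0 : ∀ x₀ b, 0 ≤ Z x₀ b := fun x₀ b => expect_nonneg' fun xs =>
        mul_nonneg (hρ _) (prod_nonneg fun i _ => hκ _ _ _)
      have hZmass : ∀ x₀, 𝔼 b, Z x₀ b = ρ₁ x₀ := fun x₀ => by
        simp only [hZ]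
        rw [expect_swap]
        refine expect_congr rfl fun xs _ => ?_
        rw [← mul_expect, expect_pi_prod fun i a => κ (β₂ x₀ xs i) (xs i) a]
        simp [hκ1]
      rw [relEnt_fin_cons]
      have hform : ∀ a b, (𝔼 x : Fin (m + 1) → Ω, ρ x * ∏ i,
          κ ((Fin.cons (β₁ (x 0)) (β₂ (x 0) (Fin.tail x)) : Fin (m + 1) → B) i) (x i)
            ((Fin.cons a b : Fin (m + 1) → Γ) i)) =
          𝔼 x₀, κ (β₁ x₀) x₀ a * Z x₀ b := fun a b => by
        rw [expect_fin_cons]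
        refine expect_congr rfl fun x₀ _ => ?_
        simp only [hZ, mul_expect]
        refine expect_congr rfl fun xs _ => ?_
        simp only [Fin.prod_univ_succ, Fin.cons_zero, Fin.cons_succ, Fin.tail_cons]
        ring
      simp only [hform]
      have h1 : ∀ a, 𝔼 b, 𝔼 x₀, κ (β₁ x₀) x₀ a * Z x₀ b = 𝔼 x₀, ρ₁ x₀ * κ (β₁ x₀) x₀ a := by
        intro a
        rw [expect_swap]
        refine expect_congr rfl fun x₀ _ => ?_
        rw [← mul_expect, hZmass, mul_comm]
      simp only [h1]
      -- Given the first output block `a`, the remaining output is a mixture of the `Z x₀` with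
      -- weights `κ (β₁ x₀) x₀ a`. Convexity applies, and the weights average to one over `a`.
      have h2 : 𝔼 a, relEnt (fun b => 𝔼 x₀, κ (β₁ x₀) x₀ a * Z x₀ b) ≤ 𝔼 x₀, relEnt (Z x₀) := by
        have : ∀ a, relEnt (fun b => 𝔼 x₀, κ (β₁ x₀) x₀ a * Z x₀ b) ≤
            𝔼 x₀, κ (β₁ x₀) x₀ a * relEnt (Z x₀) := fun a => by
          refine (relEnt_expect_le fun x₀ b => mul_nonneg (hκ _ _ _) (hZ0 _ _)).trans_eq ?_
          exact expect_congr rfl fun x₀ _ => relEnt_mul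
        refine (expect_mono this).trans_eq ?_
        rw [expect_swap]
        refine expect_congr rfl fun x₀ _ => ?_
        rw [← expect_mul, hκ1, one_mul]
      have h3 := expect_mono he₂
      rw [expect_add_distrib, ← mul_expect, ← mul_expect] at h3
      rw [relEnt_fin_cons ρ, hmass, hcast]
      change _ ≤ c₃ * (relEnt ρ₁ + _) + _
      change 𝔼 x₀, relEnt (Z x₀) ≤ _ + c₄ * m * 𝔼 x₀, ρ₁ x₀ at h3
      linarith

end Tensor

/-! ### Exponential moments and change of measure -/

section Concentration

variable {A Ω : Type*} [Fintype A] [Fintype Ω]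

/-- On `|z| ≤ 1` one has `exp z ≤ 1 + z + z²`, and the linear term has mean zero. -/
theorem exp_expect_sub_le [Nonempty A] {f : A → ℝ} {c s : ℝ} (hs : 0 ≤ s) (hsc : s * c ≤ 1)
    (hf : ∀ a b, f a ≤ f b + c) :
    𝔼 a, Real.exp (s * (𝔼 b, f b - f a)) ≤ Real.exp (s ^ 2 * c ^ 2) := by
  have habs : ∀ a, |𝔼 b, f b - f a| ≤ c := fun a => by
    rw [abs_le]
    constructor
    · have : 𝔼 _b : A, (f a - c) ≤ 𝔼 b, f b := expect_mono fun b => by linarith [hf a b]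
      rw [Fintype.expect_const] at this
      linarith
    · have : 𝔼 b, f b ≤ 𝔼 _b : A, (f a + c) := expect_mono fun b => hf b a
      rw [Fintype.expect_const] at this
      linarith
  have hpt : ∀ a, Real.exp (s * (𝔼 b, f b - f a)) ≤
      1 + s * (𝔼 b, f b - f a) + s ^ 2 * c ^ 2 := fun a => by
    have h1 : |s * (𝔼 b, f b - f a)| ≤ s * c := by
      rw [abs_mul, abs_of_nonneg hs]
      exact mul_le_mul_of_nonneg_left (habs a) hs
    have h2 := (abs_le.1 (Real.abs_exp_sub_one_sub_id_le (h1.trans hsc))).2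
    have h3 : (s * (𝔼 b, f b - f a)) ^ 2 ≤ (s * c) ^ 2 := sq_le_sq' (by
      linarith [(abs_le.1 h1).1]) (abs_le.1 h1).2
    nlinarith
  refine (expect_mono hpt).trans ?_
  simp only [expect_add_distrib, ← mul_expect, expect_sub_distrib, Fintype.expect_const]
  have := Real.add_one_le_exp (s ^ 2 * c ^ 2)
  linarith

/-- The bounded differences inequality, for the moment generating function. -/
theorem exp_expect_sub_le_of_lipschitz [Nonempty A] {c s : ℝ} (hs : 0 ≤ s) (hsc : s * c ≤ 1) :
    ∀ (m : ℕ) (f : (Fin m → A) → ℝ),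
      (∀ u i a, f u ≤ f (Function.update u i a) + c) →
      𝔼 u, Real.exp (s * (𝔼 w, f w - f u)) ≤ Real.exp (s ^ 2 * c ^ 2 * m) := by
  intro m
  induction m with
  | zero =>
    intro f _
    simp [Subsingleton.elim _ (default : Fin 0 → A)]
  | succ m ih =>
    intro f hf
    set φ : A → ℝ := fun a => 𝔼 us : Fin m → A, f (Fin.cons a us) with hφ
    have hmean : 𝔼 w, f w = 𝔼 a, φ a := expect_fin_cons f
    have hstep : ∀ a, 𝔼 us : Fin m → A, Real.exp (s * (𝔼 w, f w - f (Fin.cons a us))) ≤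
        Real.exp (s * (𝔼 b, φ b - φ a)) * Real.exp (s ^ 2 * c ^ 2 * m) := fun a => by
      have h := ih (fun us => f (Fin.cons a us)) fun u i b => by
        rw [Fin.cons_update]
        exact hf _ _ _
      refine le_trans (le_of_eq ?_) (mul_le_mul_of_nonneg_left h (Real.exp_pos _).le)
      rw [mul_expect]
      refine expect_congr rfl fun us _ => ?_
      rw [← Real.exp_add, hmean]
      congr 1
      change _ = _ + s * (φ a - _)
      ring
    rw [expect_fin_cons]
    refine (expect_mono hstep).trans ?_
    rw [← expect_mul]
    have h1 := exp_expect_sub_le (f := φ) hs hsc fun a b => by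
      have : 𝔼 us : Fin m → A, f (Fin.cons a us) ≤ 𝔼 us : Fin m → A, (f (Fin.cons b us) + c) :=
        expect_mono fun us => by
          have := hf (Fin.cons a us) 0 b
          rwa [Fin.update_cons_zero] at this
      rwa [expect_add_distrib, Fintype.expect_const] at this
    refine (mul_le_mul_of_nonneg_right h1 (Real.exp_pos _).le).trans_eq ?_
    rw [← Real.exp_add]
    congr 1
    push_cast
    ring

/-- Replacing the uniform distribution by a product of nearby densities. -/
theorem expect_mul_prod_le [Nonempty Ω] : ∀ (m : ℕ) (k ξ : Fin m → Ω → ℝ) (e : (Fin m → Ω) → ℝ),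
    (∀ i y, 0 ≤ k i y) → (∀ i, 𝔼 y, k i y = 1) → (∀ i y, k i y ≤ 1 + ξ i y) →
    (∀ i y, 0 ≤ ξ i y) → (∀ y, 0 ≤ e y) → (∀ y, e y ≤ 1) →
    𝔼 y, e y * ∏ i, k i (y i) ≤ 𝔼 y, e y + ∑ i, 𝔼 w, ξ i w := by
  intro m
  induction m with
  | zero => intros; simp
  | succ m ih =>
    intro k ξ e hk hk1 hkξ hξ he he1
    rw [expect_fin_cons, expect_fin_cons e, Fin.sum_univ_succ]
    have h1 : ∀ y₀, 𝔼 ys : Fin m → Ω, e (Fin.cons y₀ ys) *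
        ∏ i, k i ((Fin.cons y₀ ys : Fin (m + 1) → Ω) i) ≤
        (𝔼 ys : Fin m → Ω, e (Fin.cons y₀ ys) + ∑ i : Fin m, 𝔼 w, ξ i.succ w) + ξ 0 y₀ := by
      intro y₀
      have hpt : ∀ ys : Fin m → Ω, e (Fin.cons y₀ ys) *
          ∏ i, k i ((Fin.cons y₀ ys : Fin (m + 1) → Ω) i) ≤
          e (Fin.cons y₀ ys) * ∏ i : Fin m, k i.succ (ys i) +
            ξ 0 y₀ * ∏ i : Fin m, k i.succ (ys i) := fun ys => by
        simp only [Fin.prod_univ_succ, Fin.cons_zero, Fin.cons_succ]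
        have hp : 0 ≤ ∏ i : Fin m, k i.succ (ys i) := prod_nonneg fun i _ => hk _ _
        -- As `e ≤ 1`, replacing `k 0` by `1` costs only the excess `ξ 0`; the remaining factors
        -- have mean one.
        have h2 : e (Fin.cons y₀ ys) * k 0 y₀ ≤ e (Fin.cons y₀ ys) + ξ 0 y₀ := by
          nlinarith [hkξ 0 y₀, he (Fin.cons y₀ ys), he1 (Fin.cons y₀ ys), hξ 0 y₀]
        nlinarith [mul_le_mul_of_nonneg_right h2 hp]
      refine (expect_mono hpt).trans ?_
      rw [expect_add_distrib, ← mul_expect, expect_pi_prod fun i : Fin m => k i.succ]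
      simp only [hk1, prod_const_one, mul_one]
      have := ih (fun i => k i.succ) (fun i => ξ i.succ) (fun ys => e (Fin.cons y₀ ys))
        (fun i => hk _) (fun i => hk1 _) (fun i => hkξ _) (fun i => hξ _) (fun _ => he _)
        (fun _ => he1 _)
      linarith
    refine (expect_mono h1).trans ?_
    rw [expect_add_distrib, expect_add_distrib, Fintype.expect_const]
    linarith

end Concentration

/-! ### The planted distribution -/

section Densities

variable {J T T' : Type} [Fintype J] [Fintype T] [Fintype T'] [DecidableEq J] [DecidableEq T]
  [DecidableEq T']

/-- The density of a letter different from `x`. -/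
noncomputable def avoidDens (x w : T) : ℝ :=
  if w = x then 0 else (Fintype.card T : ℝ) / (Fintype.card T - 1)

/-- The density of the letter `x`. -/
noncomputable def hitDens (x w : T) : ℝ := if w = x then (Fintype.card T : ℝ) else 0

/-- The density of a word that differs from `x` everywhere except at the position `o`, if any,
where it agrees with `x`. -/
noncomputable def patDens (o : Option J) (x y : J → T) : ℝ :=
  ∏ i, if o = some i then hitDens (x i) (y i) else avoidDens (x i) (y i)

/-- The density of a word that agrees with `x` at most in one uniformly random position `j`, and
there only if `j ∈ β`. -/
noncomputable def plantDens (β : Finset J) (x y : J → T) : ℝ :=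
  𝔼 j, patDens (if j ∈ β then some j else none) x y

/-- The density of a pair of a letter `u` and a table of words: the word at `u` is planted, the
others avoid `x`. -/
noncomputable def kern (β : Finset J) (x : J → T) (a : T' × (T' → J → T)) : ℝ :=
  ∏ w, if w = a.1 then plantDens β x (a.2 w) else patDens none x (a.2 w)

theorem avoidDens_nonneg (ht : 2 ≤ Fintype.card T) (x w : T) : 0 ≤ avoidDens x w := by
  have : (2 : ℝ) ≤ Fintype.card T := by exact_mod_cast ht
  unfold avoidDens
  split_ifs
  · rfl
  · exact div_nonneg (by linarith) (by linarith)

theorem hitDens_nonneg (x w : T) : 0 ≤ hitDens x w := by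
  unfold hitDens
  split_ifs <;> positivity

theorem patDens_nonneg (ht : 2 ≤ Fintype.card T) (o : Option J) (x y : J → T) :
    0 ≤ patDens o x y :=
  prod_nonneg fun i _ => by
    split_ifs
    exacts [hitDens_nonneg _ _, avoidDens_nonneg ht _ _]

theorem plantDens_nonneg (ht : 2 ≤ Fintype.card T) (β : Finset J) (x y : J → T) :
    0 ≤ plantDens β x y :=
  expect_nonneg' fun _ => patDens_nonneg ht _ _ _

theorem kern_nonneg (ht : 2 ≤ Fintype.card T) (β : Finset J) (x : J → T)
    (a : T' × (T' → J → T)) : 0 ≤ kern β x a :=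
  prod_nonneg fun i _ => by
    split_ifs
    exacts [plantDens_nonneg ht _ _ _, patDens_nonneg ht _ _ _]

theorem expect_hitDens (ht : 2 ≤ Fintype.card T) (x : T) : 𝔼 w, hitDens x w = 1 := by
  have : (2 : ℝ) ≤ Fintype.card T := by exact_mod_cast ht
  rw [Fintype.expect_eq_sum_div_card]
  simp only [hitDens, sum_ite_eq', mem_univ, if_true]
  exact div_self (by linarith)

theorem expect_ite_eq_else (x : T) (c : ℝ) :
    𝔼 w, (if w = x then 0 else c) = c * (Fintype.card T - 1) / Fintype.card T := by
  have h : ∀ w, (if w = x then 0 else c) = c - (if w = x then c else 0) := fun w => by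
    split_ifs <;> simp
  simp only [h]
  rw [Fintype.expect_eq_sum_div_card, sum_sub_distrib]
  simp only [sum_const, sum_ite_eq', mem_univ, if_true, card_univ, nsmul_eq_mul]
  congr 1
  ring

theorem expect_avoidDens (ht : 2 ≤ Fintype.card T) (x : T) : 𝔼 w, avoidDens x w = 1 := by
  have : (2 : ℝ) ≤ Fintype.card T := by exact_mod_cast ht
  have h1 : (Fintype.card T : ℝ) - 1 ≠ 0 := by linarith
  simp only [avoidDens]
  rw [expect_ite_eq_else]
  field_simp

theorem expect_patDens (ht : 2 ≤ Fintype.card T) (o : Option J) (x : J → T) :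
    𝔼 y, patDens o x y = 1 := by
  simp only [patDens]
  rw [expect_pi_prod fun i w => if o = some i then hitDens (x i) w else avoidDens (x i) w]
  refine prod_eq_one fun i _ => ?_
  split_ifs
  exacts [expect_hitDens ht _, expect_avoidDens ht _]

theorem expect_plantDens [Nonempty J] (ht : 2 ≤ Fintype.card T) (β : Finset J) (x : J → T) :
    𝔼 y, plantDens β x y = 1 := by
  simp only [plantDens]
  rw [expect_swap]
  simp [expect_patDens ht]

theorem expect_kern_table [Nonempty J] (ht : 2 ≤ Fintype.card T) (β : Finset J) (x : J → T)
    (u : T') : 𝔼 g : T' → J → T, kern β x (u, g) = 1 := by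
  simp only [kern]
  rw [expect_pi_prod fun w y => if w = u then plantDens β x y else patDens none x y]
  refine prod_eq_one fun i _ => ?_
  split_ifs
  exacts [expect_plantDens ht _ _, expect_patDens ht _ _]

theorem expect_kern [Nonempty J] [Nonempty T'] (ht : 2 ≤ Fintype.card T) (β : Finset J)
    (x : J → T) : 𝔼 a : T' × (T' → J → T), kern β x a = 1 := by
  rw [expect_prod_type]
  simp [expect_kern_table ht]

theorem expect_hitDens_mul (x x' : T) (hT : (Fintype.card T : ℝ) ≠ 0) :
    𝔼 w, hitDens x w * hitDens x' w = if x = x' then (Fintype.card T : ℝ) else 0 := by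
  rw [Fintype.expect_eq_sum_div_card]
  simp only [hitDens, ite_mul, zero_mul, sum_ite_eq', mem_univ, if_true]
  split_ifs
  · field_simp
  · simp

theorem expect_hitDens_mul_avoidDens (ht : 2 ≤ Fintype.card T) (x x' : T) :
    𝔼 w, hitDens x w * avoidDens x' w ≤ (Fintype.card T : ℝ) / (Fintype.card T - 1) := by
  have : (2 : ℝ) ≤ Fintype.card T := by exact_mod_cast ht
  have h0 : 0 ≤ (Fintype.card T : ℝ) / (Fintype.card T - 1) :=
    div_nonneg (by linarith) (by linarith)
  rw [Fintype.expect_eq_sum_div_card]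
  simp only [hitDens, avoidDens, ite_mul, zero_mul, sum_ite_eq', mem_univ, if_true]
  split_ifs
  · simpa using h0
  · rw [mul_div_assoc, mul_div_left_comm, div_self (by linarith), mul_one]

/-- For distinct letters inclusion–exclusion gives exactly `1 - 1 / (t - 1)²`, so only coinciding
letters cost anything. -/
theorem expect_avoidDens_mul (ht : 2 ≤ Fintype.card T) (x x' : T) :
    𝔼 w, avoidDens x w * avoidDens x' w ≤
      if x = x' then (Fintype.card T : ℝ) / (Fintype.card T - 1) else 1 := by
  have : (2 : ℝ) ≤ Fintype.card T := by exact_mod_cast ht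
  set t : ℝ := (Fintype.card T : ℝ)
  have h1 : t - 1 ≠ 0 := by linarith
  split_ifs with h
  · subst h
    have : ∀ w, avoidDens x w * avoidDens x w = if w = x then 0 else (t / (t - 1)) ^ 2 := by
      intro w
      unfold avoidDens
      split_ifs <;> ring
    simp only [this]
    rw [expect_ite_eq_else]
    apply le_of_eq
    change (t / (t - 1)) ^ 2 * (t - 1) / t = _
    field_simp
  · have : ∀ w, avoidDens x w * avoidDens x' w =
        (t / (t - 1)) ^ 2 - (t / (t - 1)) ^ 2 / t * hitDens x w -
          (t / (t - 1)) ^ 2 / t * hitDens x' w := by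
      intro w
      have ht0 : t ≠ 0 := by linarith
      unfold avoidDens hitDens
      change (if w = x then 0 else t / (t - 1)) * (if w = x' then 0 else t / (t - 1)) =
        _ - _ * (if w = x then t else 0) - _ * (if w = x' then t else 0)
      split_ifs with h2 h3 h3
      · exact absurd (h2.symm.trans h3) h
      all_goals field_simp
      all_goals ring
    simp only [this, expect_sub_distrib, ← mul_expect, expect_hitDens ht]
    have : Nonempty T := ⟨x⟩
    rw [Fintype.expect_const]
    have : (t / (t - 1)) ^ 2 - (t / (t - 1)) ^ 2 / t * 1 - (t / (t - 1)) ^ 2 / t * 1 =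
        1 - 1 / (t - 1) ^ 2 := by
      have ht0 : t ≠ 0 := by linarith
      field_simp
      ring
    rw [this]
    have : 0 ≤ 1 / (t - 1) ^ 2 := by positivity
    linarith

end Densities

/-! ### Powers of `t / (t - 1)` -/

section Ratio

variable {J T T' : Type} [Fintype J] [Fintype T] [Fintype T']

theorem one_le_ratio (ht : 2 ≤ Fintype.card T) :
    1 ≤ (Fintype.card T : ℝ) / (Fintype.card T - 1) := by
  have : (2 : ℝ) ≤ Fintype.card T := by exact_mod_cast ht
  rw [le_div_iff₀ (by linarith)]
  linarith

theorem ratio_sq_le (ht : 2 ≤ Fintype.card T) :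
    ((Fintype.card T : ℝ) / (Fintype.card T - 1)) ^ 2 ≤ 1 + 8 / Fintype.card T := by
  have h2 : (2 : ℝ) ≤ Fintype.card T := by exact_mod_cast ht
  set t : ℝ := (Fintype.card T : ℝ)
  have h1 : 0 < t - 1 := by linarith
  rw [div_pow, div_le_iff₀ (by positivity)]
  have : (1 + 8 / t) * (t - 1) ^ 2 = ((t + 8) * (t - 1) ^ 2) / t := by
    field_simp
  rw [this, le_div_iff₀ (by linarith)]
  nlinarith [mul_nonneg (sub_nonneg.2 h2) (sub_nonneg.2 h2)]

/-- The number of positions where two words agree. -/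
def agree [DecidableEq T] (x x' : J → T) : ℕ := #{j | x j = x' j}

/-- Since `t / (t - 1) ≤ exp (1 / (t - 1))`, the left side is at most `exp (4 q)` with `q` the
fraction of agreeing positions. Convexity of `exp` on `[0, 4]` and `exp 4 ≤ 55` give the constant
`54`. -/
theorem ratio_pow_le [Nonempty J] [DecidableEq T] (ht : 2 ≤ Fintype.card T)
    (hJ : (Fintype.card J : ℝ) * Fintype.card T' ≤ 2 * Fintype.card T) (x x' : J → T) :
    ((Fintype.card T : ℝ) / (Fintype.card T - 1)) ^ (agree x x' * Fintype.card T') ≤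
      1 + 54 * (agree x x' / Fintype.card J) := by
  have h2 : (2 : ℝ) ≤ Fintype.card T := by exact_mod_cast ht
  have hJ0 : (0 : ℝ) < Fintype.card J := by exact_mod_cast Fintype.card_pos
  set t : ℝ := (Fintype.card T : ℝ)
  set q : ℝ := (agree x x' : ℝ) / Fintype.card J with hq
  have hq0 : 0 ≤ q := by positivity
  have hq1 : q ≤ 1 := by
    rw [hq, div_le_one hJ0]
    exact_mod_cast card_le_univ _
  have hτ : t / (t - 1) ≤ Real.exp (1 / (t - 1)) := by
    have := Real.add_one_le_exp (1 / (t - 1))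
    refine le_trans (le_of_eq ?_) this
    have : t - 1 ≠ 0 := by linarith
    field_simp
    ring
  have h3 : (t / (t - 1)) ^ (agree x x' * Fintype.card T') ≤ Real.exp (q * 4) := by
    refine (pow_le_pow_left₀ (div_nonneg (by linarith) (by linarith)) hτ _).trans ?_
    rw [← Real.exp_nat_mul]
    apply Real.exp_le_exp.2
    push_cast
    have h4 : (agree x x' : ℝ) = q * Fintype.card J := by rw [hq]; field_simp
    rw [h4, mul_one_div, div_le_iff₀ (by linarith)]
    have : q * (Fintype.card J * Fintype.card T') ≤ q * (2 * t) := by gcongr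
    nlinarith
  have hconv := convexOn_exp.2 (Set.mem_univ (0 : ℝ)) (Set.mem_univ (4 : ℝ))
    (sub_nonneg.2 hq1) hq0 (by ring)
  simp only [smul_eq_mul, mul_zero, zero_add, Real.exp_zero, mul_one] at hconv
  have he : Real.exp 4 ≤ 55 := by
    have h := Real.exp_one_lt_d9
    have : Real.exp 4 = Real.exp 1 ^ 4 := by rw [← Real.exp_nat_mul]; norm_num
    rw [this]
    calc Real.exp 1 ^ 4 ≤ 2.7182818286 ^ 4 := by gcongr
      _ ≤ 55 := by norm_num
  nlinarith

end Ratio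

/-! ### Correlations of planted densities -/

section SecondMoment

variable {J T T' : Type} [Fintype J] [Fintype T] [Fintype T'] [DecidableEq J] [DecidableEq T]
  [DecidableEq T']

theorem expect_patDens_mul (ht : 2 ≤ Fintype.card T) (o o' : Option J) (x x' : J → T) :
    𝔼 y, patDens o x y * patDens o' x' y ≤
      ((Fintype.card T : ℝ) / (Fintype.card T - 1)) ^ agree x x' *
        ∏ i, (if o = some i ∧ o' = some i then (if x i = x' i then (Fintype.card T : ℝ) else 0)
          else (if o = some i then (Fintype.card T : ℝ) / (Fintype.card T - 1) else 1) *
            (if o' = some i then (Fintype.card T : ℝ) / (Fintype.card T - 1) else 1)) := by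
  have h2 : (2 : ℝ) ≤ Fintype.card T := by exact_mod_cast ht
  set τ : ℝ := (Fintype.card T : ℝ) / (Fintype.card T - 1)
  have hτ : 1 ≤ τ := one_le_ratio ht
  have hpow : τ ^ agree x x' = ∏ i, if x i = x' i then τ else 1 := by
    rw [prod_ite, prod_const, prod_const_one, mul_one, agree]
  rw [hpow, ← prod_mul_distrib]
  simp only [patDens, ← prod_mul_distrib]
  rw [expect_pi_prod fun i w => (if o = some i then hitDens (x i) w else avoidDens (x i) w) *
    (if o' = some i then hitDens (x' i) w else avoidDens (x' i) w)]
  refine prod_le_prod (fun i _ => expect_nonneg' fun w => mul_nonneg ?_ ?_) fun i _ => ?_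
  · split_ifs
    exacts [hitDens_nonneg _ _, avoidDens_nonneg ht _ _]
  · split_ifs
    exacts [hitDens_nonneg _ _, avoidDens_nonneg ht _ _]
  have hs : 1 ≤ if x i = x' i then τ else 1 := by split_ifs <;> simp [hτ]
  by_cases ho : o = some i <;> by_cases ho' : o' = some i <;>
    simp only [ho, ho', and_true, and_false, if_true, if_false, one_mul, mul_one]
  · rw [expect_hitDens_mul _ _ (by linarith)]
    split_ifs
    · nlinarith
    · simp
  · have := expect_hitDens_mul_avoidDens ht (x i) (x' i)
    change _ ≤ τ at this
    nlinarith
  · have := expect_hitDens_mul_avoidDens ht (x' i) (x i)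
    simp only [mul_comm (hitDens _ _)] at this
    change _ ≤ τ at this
    nlinarith
  · exact expect_avoidDens_mul ht _ _

theorem prod_ite_some_le {τ : ℝ} (hτ : 1 ≤ τ) (o : Option J) :
    ∏ i, (if o = some i then τ else 1) ≤ τ := by
  rcases o with _ | j
  · simpa using hτ
  · simp [prod_ite_eq]

theorem expect_patDens_mul_le (ht : 2 ≤ Fintype.card T) (o o' : Option J) (x x' : J → T)
    (h : ∀ j, ¬ (o = some j ∧ o' = some j)) :
    𝔼 y, patDens o x y * patDens o' x' y ≤
      ((Fintype.card T : ℝ) / (Fintype.card T - 1)) ^ agree x x' *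
        ((Fintype.card T : ℝ) / (Fintype.card T - 1)) ^ 2 := by
  have hτ := one_le_ratio ht
  refine (expect_patDens_mul ht o o' x x').trans
    (mul_le_mul_of_nonneg_left ?_ (pow_nonneg (zero_le_one.trans hτ) _))
  simp only [h, if_false, prod_mul_distrib, sq]
  refine mul_le_mul (prod_ite_some_le hτ _) (prod_ite_some_le hτ _)
    (prod_nonneg fun i _ => ?_) (zero_le_one.trans hτ)
  split_ifs
  exacts [zero_le_one.trans hτ, zero_le_one]

theorem expect_patDens_mul_same (ht : 2 ≤ Fintype.card T) (j : J) (x x' : J → T) :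
    𝔼 y, patDens (some j) x y * patDens (some j) x' y ≤
      ((Fintype.card T : ℝ) / (Fintype.card T - 1)) ^ agree x x' *
        (if x j = x' j then (Fintype.card T : ℝ) else 0) := by
  refine (expect_patDens_mul ht _ _ x x').trans_eq ?_
  congr 1
  rw [prod_eq_single j]
  · simp
  · intro i _ hi
    have : ¬ (some j = some i) := fun h => hi (Option.some_injective _ h).symm
    simp [this]
  · simp

/-- Two independent planted positions coincide with probability `1 / |J|`; only then can a factor
`t` arise, and only if `x` and `x'` agree there. Keeping just the condition on `β` is enough later.
-/
theorem expect_plantDens_mul_le [Nonempty J] (ht : 2 ≤ Fintype.card T) (β β' : Finset J)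
    (x x' : J → T) :
    𝔼 y, plantDens β x y * plantDens β' x' y ≤
      ((Fintype.card T : ℝ) / (Fintype.card T - 1)) ^ agree x x' *
        (((Fintype.card T : ℝ) / (Fintype.card T - 1)) ^ 2 +
          (𝔼 j, if j ∈ β ∧ x j = x' j then (Fintype.card T : ℝ) else 0) / Fintype.card J) := by
  set τ : ℝ := (Fintype.card T : ℝ) / (Fintype.card T - 1) with hτdef
  have hτ : 1 ≤ τ := one_le_ratio ht
  have hpow : 0 ≤ τ ^ agree x x' := pow_nonneg (by linarith) _
  have h1 : ∀ j k, 𝔼 y, patDens (if j ∈ β then some j else none) x y *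
      patDens (if k ∈ β' then some k else none) x' y ≤
      τ ^ agree x x' * (τ ^ 2 + if j = k then
        (if j ∈ β ∧ x j = x' j then (Fintype.card T : ℝ) else 0) else 0) := by
    intro j k
    by_cases hjk : j = k ∧ j ∈ β ∧ k ∈ β'
    · obtain ⟨rfl, hj, hk⟩ := hjk
      simp only [hj, hk, if_true, true_and]
      refine (expect_patDens_mul_same ht j x x').trans ?_
      gcongr
      nlinarith
    · refine (expect_patDens_mul_le ht _ _ x x' ?_).trans ?_
      · rintro i ⟨hi, hi'⟩
        apply hjk
        split_ifs at hi with h1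
        split_ifs at hi' with h2
        exact ⟨by rw [Option.some_injective _ hi, Option.some_injective _ hi'], h1, h2⟩
      · refine mul_le_mul_of_nonneg_left ?_ hpow
        refine le_add_of_nonneg_right ?_
        split_ifs <;> positivity
  have h2 : 𝔼 y, plantDens β x y * plantDens β' x' y = 𝔼 j, 𝔼 k, 𝔼 y,
      patDens (if j ∈ β then some j else none) x y *
        patDens (if k ∈ β' then some k else none) x' y := by
    simp only [plantDens, expect_mul_expect]
    rw [expect_swap]
    exact expect_congr rfl fun j _ => expect_swap _
  rw [h2]
  refine (expect_mono fun j => expect_mono fun k => h1 j k).trans_eq ?_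
  simp only [← mul_expect, expect_add_distrib, Fintype.expect_const]
  congr 2
  rw [expect_div]
  refine expect_congr rfl fun j _ => ?_
  rw [Fintype.expect_eq_sum_div_card]
  simp

theorem expect_kern_mul_le [Nonempty J] [Nonempty T'] (ht : 2 ≤ Fintype.card T) (β β' : Finset J)
    (x x' : J → T) :
    𝔼 a : T' × (T' → J → T), kern β x a * kern β' x' a ≤
      ((Fintype.card T : ℝ) / (Fintype.card T - 1)) ^ (agree x x' * Fintype.card T') *
        (((Fintype.card T : ℝ) / (Fintype.card T - 1)) ^ 2 +
          (𝔼 j, if j ∈ β ∧ x j = x' j then (Fintype.card T : ℝ) else 0) / Fintype.card J) := by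
  set τ : ℝ := (Fintype.card T : ℝ) / (Fintype.card T - 1) with hτdef
  have hτ : 1 ≤ τ := one_le_ratio ht
  have hpow : 0 ≤ τ ^ agree x x' := pow_nonneg (by linarith) _
  set R : ℝ := τ ^ 2 +
    (𝔼 j, if j ∈ β ∧ x j = x' j then (Fintype.card T : ℝ) else 0) / Fintype.card J with hR
  rw [expect_prod_type]
  refine expect_le univ_nonempty fun u _ => ?_
  simp only [kern, ← prod_mul_distrib]
  rw [expect_pi_prod fun w y => (if w = u then plantDens β x y else patDens none x y) *
    (if w = u then plantDens β' x' y else patDens none x' y)]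
  have h1 : ∏ w : T', (τ ^ agree x x' * if w = u then R else 1) =
      τ ^ (agree x x' * Fintype.card T') * R := by
    rw [prod_mul_distrib, prod_const, card_univ, prod_ite_eq', if_pos (mem_univ _), ← pow_mul]
  rw [← h1]
  refine prod_le_prod (fun w _ => expect_nonneg' fun y => mul_nonneg ?_ ?_) fun w _ => ?_
  · split_ifs
    exacts [plantDens_nonneg ht _ _ _, patDens_nonneg ht _ _ _]
  · split_ifs
    exacts [plantDens_nonneg ht _ _ _, patDens_nonneg ht _ _ _]
  split_ifs
  · exact expect_plantDens_mul_le ht β β' x x'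
  · refine (expect_patDens_mul ht none none x x').trans_eq ?_
    simp [hτdef]

end SecondMoment

/-! ### Relative entropy of planting in one block -/

section Block

variable {J T T' : Type} [Fintype J] [Fintype T] [Fintype T'] [DecidableEq J] [DecidableEq T]
  [DecidableEq T']

/-- The density of the `j`-th letter of a word with density `ρ`. -/
noncomputable def marg (ρ : (J → T) → ℝ) (j : J) (a : T) : ℝ :=
  Fintype.card T * 𝔼 x, ρ x * if x j = a then 1 else 0

/-- The positions of `x` whose letter is not too likely under `ρ`. -/
noncomputable def lightPos (ρ : (J → T) → ℝ) (K : ℝ) (x : J → T) : Finset J :=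
  {j | marg ρ j (x j) ≤ K}

theorem marg_nonneg {ρ : (J → T) → ℝ} (hρ : ∀ x, 0 ≤ ρ x) (j : J) (a : T) : 0 ≤ marg ρ j a :=
  mul_nonneg (Nat.cast_nonneg _) <| expect_nonneg' fun x =>
    mul_nonneg (hρ x) (by split_ifs <;> norm_num)

theorem marg_le {ρ : (J → T) → ℝ} (hρ : ∀ x, 0 ≤ ρ x) (h1 : 𝔼 x, ρ x = 1) (j : J) (a : T) :
    marg ρ j a ≤ Fintype.card T := by
  refine mul_le_of_le_one_right (Nat.cast_nonneg _) ?_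
  refine le_trans (expect_mono fun x => ?_) h1.le
  split_ifs
  · rw [mul_one]
  · rw [mul_zero]
    exact hρ x

theorem expect_marg [Nonempty T] {ρ : (J → T) → ℝ} (h1 : 𝔼 x, ρ x = 1) (j : J) :
    𝔼 a, marg ρ j a = 1 := by
  simp only [marg]
  rw [← mul_expect, expect_swap]
  have : ∀ x : J → T, 𝔼 a, ρ x * (if x j = a then 1 else 0) = ρ x / Fintype.card T := by
    intro x
    rw [Fintype.expect_eq_sum_div_card]
    simp
  simp only [this]
  rw [← expect_div, h1]
  have : (Fintype.card T : ℝ) ≠ 0 := by exact_mod_cast Fintype.card_ne_zero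
  field_simp

/-- Donsker–Varadhan against the uniform law: the factor of a position is `K` only if `marg` exceeds
`K`, hence at most `1 + marg`, which has mean `2`. So the exponential moment of the number of heavy
positions is at most `2 ^ |J|`. -/
theorem expect_card_heavy_le [Nonempty T] {ρ : (J → T) → ℝ} (hρ : ∀ x, 0 ≤ ρ x)
    (h1 : 𝔼 x, ρ x = 1) {K : ℝ} (hK : 1 < K) :
    Real.log K * 𝔼 x, ρ x * (#(lightPos ρ K x)ᶜ : ℝ) ≤ relEnt ρ + Fintype.card J := by
  have h2 := expect_mul_le_relEnt (Φ := fun x => Real.log K * (#(lightPos ρ K x)ᶜ : ℝ)) hρ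
  rw [h1, one_mul] at h2
  have h3 : 𝔼 x, Real.exp (Real.log K * (#(lightPos ρ K x)ᶜ : ℝ)) ≤ 2 ^ Fintype.card J := by
    have hform : ∀ x : J → T, Real.exp (Real.log K * (#(lightPos ρ K x)ᶜ : ℝ)) =
        ∏ j, if marg ρ j (x j) ≤ K then 1 else K := by
      intro x
      rw [mul_comm, Real.exp_nat_mul, Real.exp_log (by linarith), prod_ite, prod_const_one,
        one_mul, prod_const, lightPos, compl_filter]
    simp only [hform]
    rw [expect_pi_prod fun j a => if marg ρ j a ≤ K then (1 : ℝ) else K]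
    rw [← card_univ, ← prod_const]
    refine prod_le_prod (fun j _ => expect_nonneg' fun a => by split_ifs <;> linarith)
      fun j _ => ?_
    have : ∀ a, (if marg ρ j a ≤ K then (1 : ℝ) else K) ≤ 1 + marg ρ j a := fun a => by
      have := marg_nonneg hρ j a
      split_ifs <;> linarith
    refine (expect_mono this).trans_eq ?_
    rw [expect_add_distrib, Fintype.expect_const, expect_marg h1]
    norm_num
  have h4 : Real.log (𝔼 x, Real.exp (Real.log K * (#(lightPos ρ K x)ᶜ : ℝ))) ≤
      Fintype.card J := by
    refine (Real.log_le_log (expect_pos (fun _ _ => Real.exp_pos _) univ_nonempty) h3).trans ?_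
    rw [Real.log_pow]
    have : Real.log 2 ≤ 1 := by linarith [Real.log_two_lt_d9]
    exact mul_le_of_le_one_right (Nat.cast_nonneg _) this
  simp only [mul_left_comm _ (Real.log K)] at h2
  rw [← mul_expect] at h2
  linarith

/-- The second moment of the mixture is the correlation of two kernels averaged over independent `x,
x'` with density `ρ`. The constant is `279 = 8 + 216 + 55`, from `8 / t`, agreements, and coinciding
planted positions. -/
theorem relEnt_mixture_le [Nonempty J] [Nonempty T'] (ht : 2 ≤ Fintype.card T)
    (hJ : (Fintype.card J : ℝ) * Fintype.card T' ≤ 2 * Fintype.card T)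
    (hJT : Fintype.card J ≤ Fintype.card T)
    {ρ : (J → T) → ℝ} (hρ : ∀ x, 0 ≤ ρ x) (h1 : 𝔼 x, ρ x = 1) {K : ℝ} (hK : 1 < K) :
    relEnt (fun a : T' × (T' → J → T) => 𝔼 x, ρ x * kern (lightPos ρ K x) x a) ≤
      279 * (K / Fintype.card J) +
        216 * ((𝔼 x, ρ x * (#(lightPos ρ K x)ᶜ : ℝ)) / Fintype.card J) := by
  have h2 : (2 : ℝ) ≤ Fintype.card T := by exact_mod_cast ht
  have hJ0 : (0 : ℝ) < Fintype.card J := by exact_mod_cast Fintype.card_pos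
  have hJT' : (Fintype.card J : ℝ) ≤ Fintype.card T := by exact_mod_cast hJT
  set t : ℝ := (Fintype.card T : ℝ) with htdef
  set ℓ : ℝ := (Fintype.card J : ℝ) with hldef
  have hnn : ∀ a : T' × (T' → J → T), 0 ≤ 𝔼 x, ρ x * kern (lightPos ρ K x) x a := fun a =>
    expect_nonneg' fun x => mul_nonneg (hρ x) (kern_nonneg ht _ _ _)
  have hmass : 𝔼 a : T' × (T' → J → T), 𝔼 x, ρ x * kern (lightPos ρ K x) x a = 1 := by
    rw [expect_swap]
    simp only [← mul_expect, expect_kern ht, mul_one, h1]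
  refine (relEnt_le_sq hnn hmass).trans ?_
  set q : (J → T) → (J → T) → ℝ := fun x x' => agree x x' / ℓ with hq
  set R : (J → T) → (J → T) → ℝ := fun x x' =>
    (𝔼 j, if j ∈ lightPos ρ K x ∧ x j = x' j then t else 0) / ℓ with hR
  -- Here `216 = 54 * 4` uses `(t / (t - 1))² ≤ 4`, and `55 = 1 + 54` uses `q ≤ 1`.
  have hqR : ∀ x x', 𝔼 a : T' × (T' → J → T),
      kern (lightPos ρ K x) x a * kern (lightPos ρ K x') x' a ≤
        1 + 8 / t + 216 * q x x' + 55 * R x x' := by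
    intro x x'
    refine (expect_kern_mul_le ht _ _ x x').trans ?_
    have e1 := ratio_pow_le (T' := T') ht hJ x x'
    have e2 := ratio_sq_le ht
    have hq0 : 0 ≤ q x x' := by positivity
    have hq1 : q x x' ≤ 1 := by
      simp only [hq]
      rw [div_le_one hJ0, hldef]
      exact_mod_cast card_le_univ _
    have hR0 : 0 ≤ R x x' := by
      refine div_nonneg (expect_nonneg' fun j => ?_) hJ0.le
      split_ifs <;> positivity
    have hτ0 : 0 ≤ (t / (t - 1)) ^ 2 := sq_nonneg _
    have e3 : (t / (t - 1)) ^ 2 ≤ 4 := by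
      have : t / (t - 1) ≤ 2 := by rw [div_le_iff₀ (by linarith)]; linarith
      have h0 : 0 ≤ t / (t - 1) := div_nonneg (by linarith) (by linarith)
      nlinarith
    calc _ ≤ (1 + 54 * q x x') * ((t / (t - 1)) ^ 2 + R x x') := by
          refine mul_le_mul_of_nonneg_right e1 (by positivity)
      _ ≤ _ := by nlinarith [mul_nonneg hq0 (sub_nonneg.2 e3), mul_nonneg hR0 (sub_nonneg.2 hq1)]
  have hmom : 𝔼 a : T' × (T' → J → T), (𝔼 x, ρ x * kern (lightPos ρ K x) x a) ^ 2 ≤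
      𝔼 x, 𝔼 x', ρ x * ρ x' * (1 + 8 / t + 216 * q x x' + 55 * R x x') := by
    have : 𝔼 a : T' × (T' → J → T), (𝔼 x, ρ x * kern (lightPos ρ K x) x a) ^ 2 =
        𝔼 x, 𝔼 x', ρ x * ρ x' * 𝔼 a : T' × (T' → J → T),
          kern (lightPos ρ K x) x a * kern (lightPos ρ K x') x' a := by
      simp only [sq, expect_mul_expect]
      rw [expect_swap]
      refine expect_congr rfl fun x _ => ?_
      rw [expect_swap]
      refine expect_congr rfl fun x' _ => ?_
      rw [mul_expect]
      refine expect_congr rfl fun a _ => ?_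
      ring
    rw [this]
    exact expect_mono fun x => expect_mono fun x' =>
      mul_le_mul_of_nonneg_left (hqR x x') (mul_nonneg (hρ x) (hρ x'))
  have hsplit : 𝔼 x, 𝔼 x', ρ x * ρ x' * (1 + 8 / t + 216 * q x x' + 55 * R x x') =
      1 + 8 / t + 216 * (𝔼 x, ρ x * 𝔼 x', ρ x' * q x x') +
        55 * (𝔼 x, ρ x * 𝔼 x', ρ x' * R x x') := by
    simp only [mul_expect]
    have : 1 + 8 / t = 𝔼 x, 𝔼 x', ρ x * ρ x' * (1 + 8 / t) := by
      simp only [← expect_mul, ← mul_expect, h1, one_mul, mul_one]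
    conv_rhs => rw [this]
    simp only [← expect_add_distrib]
    refine expect_congr rfl fun x _ => expect_congr rfl fun x' _ => ?_
    ring
  have hmargx : ∀ j (x : J → T), 𝔼 x', ρ x' * (if x j = x' j then 1 else 0) =
      marg ρ j (x j) / t := by
    intro j x
    rw [marg, ← htdef, mul_div_cancel_left₀ _ (by linarith)]
    refine expect_congr rfl fun x' _ => ?_
    rw [if_congr eq_comm rfl rfl]
  have hqb : ∀ x, 𝔼 x', ρ x' * q x x' ≤ K / ℓ + (#(lightPos ρ K x)ᶜ : ℝ) / ℓ := by
    intro x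
    have : ∀ x', ρ x' * q x x' = 𝔼 j, ρ x' * (if x j = x' j then 1 else 0) := by
      intro x'
      rw [← mul_expect, Fintype.expect_eq_sum_div_card]
      simp [hq, agree, hldef]
    simp only [this]
    rw [expect_swap]
    simp only [hmargx]
    have : ∀ j, marg ρ j (x j) / t ≤ K / ℓ + if j ∈ (lightPos ρ K x)ᶜ then 1 else 0 := by
      intro j
      by_cases hj : marg ρ j (x j) ≤ K
      · simp only [lightPos, mem_compl, mem_filter, mem_univ, true_and, hj, not_true, if_false,
          add_zero]
        exact div_le_div₀ (by linarith) hj hJ0 hJT'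
      · simp only [lightPos, mem_compl, mem_filter, mem_univ, true_and, hj, not_false_iff,
          if_true]
        have : marg ρ j (x j) / t ≤ 1 := by
          rw [div_le_one (by linarith)]
          exact marg_le hρ h1 _ _
        have : 0 ≤ K / ℓ := div_nonneg (by linarith) hJ0.le
        linarith
    refine (expect_mono this).trans_eq ?_
    rw [expect_add_distrib, Fintype.expect_const, Fintype.expect_eq_sum_div_card, sum_boole,
      filter_univ_mem]
  -- Lightness enters here: averaging `t` times the indicator of `x j = x' j` over `x'` gives `marg
  -- ρ j (x j)`, which is at most `K` on light positions.
  have hRb : ∀ x, 𝔼 x', ρ x' * R x x' ≤ K / ℓ := by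
    intro x
    have : ∀ x', ρ x' * R x x' = (𝔼 j, (if j ∈ lightPos ρ K x then t else 0) *
        (ρ x' * (if x j = x' j then 1 else 0))) / ℓ := by
      intro x'
      simp only [hR]
      rw [← mul_div_assoc, mul_expect]
      congr 1
      refine expect_congr rfl fun j _ => ?_
      by_cases h3 : j ∈ lightPos ρ K x <;> by_cases h4 : x j = x' j <;> simp [h3, h4, mul_comm]
    simp only [this]
    rw [← expect_div, expect_swap]
    gcongr
    refine expect_le univ_nonempty fun j _ => ?_
    rw [← mul_expect, hmargx]
    split_ifs with h3
    · rw [mul_div_cancel₀ _ (by linarith)]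
      simpa [lightPos] using h3
    · rw [zero_mul]; linarith
  have hq2 : 𝔼 x, ρ x * 𝔼 x', ρ x' * q x x' ≤
      K / ℓ + (𝔼 x, ρ x * (#(lightPos ρ K x)ᶜ : ℝ)) / ℓ := by
    refine (expect_mono fun x => mul_le_mul_of_nonneg_left (hqb x) (hρ x)).trans_eq ?_
    simp only [mul_add, expect_add_distrib, ← expect_mul, h1, one_mul, ← mul_div_assoc,
      ← expect_div]
  have hR2 : 𝔼 x, ρ x * 𝔼 x', ρ x' * R x x' ≤ K / ℓ := by
    refine (expect_mono fun x => mul_le_mul_of_nonneg_left (hRb x) (hρ x)).trans_eq ?_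
    rw [← expect_mul, h1, one_mul]
  have h8 : 8 / t ≤ 8 * (K / ℓ) := by
    rw [← mul_div_assoc]
    exact div_le_div₀ (by linarith) (by linarith) hJ0 hJT'
  rw [hsplit] at hmom
  linarith

/-- The labels are the light positions of the normalized density; homogeneity of `relEnt` restores
the mass. -/
theorem exists_block_labelling [Nonempty J] [Nonempty T'] (ht : 2 ≤ Fintype.card T)
    (hJ : (Fintype.card J : ℝ) * Fintype.card T' ≤ 2 * Fintype.card T)
    (hJT : Fintype.card J ≤ Fintype.card T) {K : ℝ} (hK : 1 < K)
    (ρ : (J → T) → ℝ) (hρ : ∀ x, 0 ≤ ρ x) :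
    ∃ β : (J → T) → Finset J,
      𝔼 x, ρ x * (#(β x)ᶜ : ℝ) ≤ (Real.log K)⁻¹ * relEnt ρ +
        Fintype.card J * (Real.log K)⁻¹ * 𝔼 x, ρ x ∧
      relEnt (fun a : T' × (T' → J → T) => 𝔼 x, ρ x * kern (β x) x a) ≤
        216 * (Real.log K)⁻¹ / Fintype.card J * relEnt ρ +
          (279 * (K / Fintype.card J) + 216 * (Real.log K)⁻¹) * 𝔼 x, ρ x := by
  have hJ0 : (0 : ℝ) < Fintype.card J := by exact_mod_cast Fintype.card_pos
  have : Nonempty T := Fintype.card_pos_iff.1 (by omega)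
  have hlog : 0 < Real.log K := Real.log_pos hK
  rcases (expect_nonneg' hρ).eq_or_lt with h0 | hμ
  · have hf0 : ρ = 0 := (Fintype.expect_eq_zero_iff_of_nonneg hρ).1 h0.symm
    refine ⟨fun _ => ∅, ?_, ?_⟩ <;> simp [relEnt, hf0]
  set M : ℝ := 𝔼 x, ρ x with hM
  set σ : (J → T) → ℝ := fun x => M⁻¹ * ρ x with hσ
  have hσ0 : ∀ x, 0 ≤ σ x := fun x => mul_nonneg (inv_nonneg.2 hμ.le) (hρ x)
  have hσ1 : 𝔼 x, σ x = 1 := by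
    simp only [hσ]
    rw [← mul_expect, inv_mul_cancel₀ hμ.ne']
  have hρσ : ρ = fun x => M * σ x := by
    funext x
    simp only [hσ]
    field_simp
  have hE : relEnt ρ = M * relEnt σ := by rw [hρσ, relEnt_mul]
  have h1 := expect_card_heavy_le hσ0 hσ1 hK
  have h2 := relEnt_mixture_le (T' := T') ht hJ hJT hσ0 hσ1 hK
  have h1' : 𝔼 x, σ x * (#(lightPos σ K x)ᶜ : ℝ) ≤
      (Real.log K)⁻¹ * (relEnt σ + Fintype.card J) := by
    rw [inv_mul_eq_div, le_div_iff₀ hlog]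
    linarith
  refine ⟨lightPos σ K, ?_, ?_⟩
  · rw [hE]
    have : 𝔼 x, ρ x * (#(lightPos σ K x)ᶜ : ℝ) = M * 𝔼 x, σ x * (#(lightPos σ K x)ᶜ : ℝ) := by
      rw [mul_expect]
      refine expect_congr rfl fun x _ => ?_
      rw [congrFun hρσ x, mul_assoc]
    rw [this]
    have := mul_le_mul_of_nonneg_left h1' hμ.le
    linarith
  · have : (fun a : T' × (T' → J → T) => 𝔼 x, ρ x * kern (lightPos σ K x) x a) =
        fun a => M * 𝔼 x, σ x * kern (lightPos σ K x) x a := by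
      funext a
      rw [mul_expect]
      refine expect_congr rfl fun x _ => ?_
      rw [congrFun hρσ x, mul_assoc]
    rw [this, relEnt_mul, hE]
    have h3 : (𝔼 x, σ x * (#(lightPos σ K x)ᶜ : ℝ)) / Fintype.card J ≤
        (Real.log K)⁻¹ * (relEnt σ + Fintype.card J) / Fintype.card J := by gcongr
    have h4 : (Real.log K)⁻¹ * (relEnt σ + Fintype.card J) / Fintype.card J =
        (Real.log K)⁻¹ / Fintype.card J * relEnt σ + (Real.log K)⁻¹ := by
      field_simp
    have := mul_le_mul_of_nonneg_left (h2.trans (by linarith : _ ≤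
      279 * (K / Fintype.card J) + 216 * ((Real.log K)⁻¹ / Fintype.card J * relEnt σ +
        (Real.log K)⁻¹))) hμ.le
    refine this.trans_eq ?_
    ring

end Block

/-! ### The receiver's view of the planted table -/

section Receiver

variable {J T T' : Type} [Fintype J] [Fintype T] [Fintype T'] [DecidableEq J] [DecidableEq T]
  [DecidableEq T']

theorem patDens_none_eq_zero {x y : J → T} {j : J} (h : y j = x j) : patDens none x y = 0 :=
  prod_eq_zero (mem_univ j) (by simp [avoidDens, h])

theorem patDens_some_eq_zero {x y : J → T} {j : J} (h : y j ≠ x j) : patDens (some j) x y = 0 :=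
  prod_eq_zero (mem_univ j) (by simp [hitDens, h])

theorem patDens_some_eq_zero' {x y : J → T} {i j : J} (hij : i ≠ j) (h : y j = x j) :
    patDens (some i) x y = 0 :=
  prod_eq_zero (mem_univ j) (by simp [avoidDens, h, hij])

/-- The left side is the uniform density restricted to words agreeing with `x` in at most one
position: its coefficients are the probabilities of no agreement and of agreement exactly at `j`. -/
theorem patterns_le_one [Nonempty J] (ht : 2 ≤ Fintype.card T) (x y : J → T) :
    (1 - 1 / (Fintype.card T : ℝ)) ^ Fintype.card J * patDens none x y +
      (1 - 1 / (Fintype.card T : ℝ)) ^ (Fintype.card J - 1) / Fintype.card T *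
        ∑ j, patDens (some j) x y ≤ 1 := by
  have h2 : (2 : ℝ) ≤ Fintype.card T := by exact_mod_cast ht
  have hinv : (1 - 1 / (Fintype.card T : ℝ)) * ((Fintype.card T : ℝ) / (Fintype.card T - 1)) = 1 := by
    have : (Fintype.card T : ℝ) - 1 ≠ 0 := by linarith
    field_simp
  have hτ := one_le_ratio ht
  have hσ : 0 ≤ 1 - 1 / (Fintype.card T : ℝ) := by
    rw [sub_nonneg, div_le_one (by linarith)]
    linarith
  by_cases h : ∀ j, y j ≠ x j
  · have h1 : ∀ j, patDens (some j) x y = 0 := fun j => patDens_some_eq_zero (h j)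
    have h3 : patDens none x y =
        ((Fintype.card T : ℝ) / (Fintype.card T - 1)) ^ Fintype.card J := by
      simp [patDens, avoidDens, h, div_pow]
    simp only [h1, h3, sum_const_zero, mul_zero, add_zero, ← mul_pow, hinv, one_pow, le_refl]
  · push Not at h
    obtain ⟨j, hj⟩ := h
    rw [patDens_none_eq_zero hj, mul_zero, zero_add,
      sum_eq_single j (fun i _ hi => patDens_some_eq_zero' hi hj) (by simp)]
    have h1 : patDens (some j) x y ≤ Fintype.card T *
        ((Fintype.card T : ℝ) / (Fintype.card T - 1)) ^ (Fintype.card J - 1) := by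
      rw [patDens, ← mul_prod_erase univ _ (mem_univ j), ← card_univ (α := J),
        ← card_erase_of_mem (mem_univ j), ← prod_const]
      refine mul_le_mul ?_ (prod_le_prod (fun i _ => ?_) fun i hi => ?_)
        (prod_nonneg fun i _ => ?_) (Nat.cast_nonneg _)
      · simp [hitDens, hj]
      · split_ifs
        exacts [hitDens_nonneg _ _, avoidDens_nonneg ht _ _]
      · have : ¬ (some j = some i) := fun h => (mem_erase.1 hi).1 (Option.some_injective _ h).symm
        rw [if_neg this, avoidDens]
        split_ifs
        · exact zero_le_one.trans hτ
        · rfl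
      · split_ifs
        exacts [hitDens_nonneg _ _, avoidDens_nonneg ht _ _]
    refine (mul_le_mul_of_nonneg_left h1 (by positivity)).trans_eq ?_
    have : (Fintype.card T : ℝ) ≠ 0 := by linarith
    rw [div_mul_eq_mul_div, mul_left_comm, mul_div_cancel_left₀ _ this, ← mul_pow, hinv, one_pow]

theorem plantDens_eq (β : Finset J) (x y : J → T) :
    plantDens β x y = (∑ j ∈ β, patDens (some j) x y + #βᶜ * patDens none x y) /
      Fintype.card J := by
  rw [plantDens, Fintype.expect_eq_sum_div_card]
  congr 1
  have : ∀ j, patDens (if j ∈ β then some j else none) x y =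
      if j ∈ β then patDens (some j) x y else patDens none x y := fun j => by
    split_ifs <;> rfl
  simp only [this]
  rw [sum_ite, filter_univ_mem, sum_const, nsmul_eq_mul, ← compl_filter, filter_univ_mem]

/-- The density of the table entry that the receiver reads. -/
noncomputable def readDens (T' : Type) [Fintype T'] (β : Finset J) (x y : J → T) : ℝ :=
  1 / (Fintype.card T' : ℝ) * plantDens β x y +
    (1 - 1 / (Fintype.card T' : ℝ)) * patDens none x y

/-- An upper bound for the excess of `readDens` over the uniform density. -/
noncomputable def excessDens (T' : Type) [Fintype T'] (β : Finset J) (x y : J → T) : ℝ :=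
  ((Fintype.card J : ℝ) / Fintype.card T - 1 / (Fintype.card T' : ℝ) +
    #βᶜ / ((Fintype.card J : ℝ) * Fintype.card T')) * patDens none x y +
  (Fintype.card J : ℝ) / (Fintype.card T : ℝ) ^ 2 * ∑ j, patDens (some j) x y

variable [Nonempty J] [Nonempty T']

theorem excess_coeff_nonneg (ht : 2 ≤ Fintype.card T)
    (hT : (Fintype.card T : ℝ) ≤ Fintype.card J * Fintype.card T') :
    0 ≤ (Fintype.card J : ℝ) / Fintype.card T - 1 / (Fintype.card T' : ℝ) := by
  have h2 : (2 : ℝ) ≤ Fintype.card T := by exact_mod_cast ht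
  have ht' : (0 : ℝ) < Fintype.card T' := by exact_mod_cast Fintype.card_pos
  rw [sub_nonneg, div_le_div_iff₀ ht' (by linarith)]
  linarith

theorem excessDens_nonneg (ht : 2 ≤ Fintype.card T)
    (hT : (Fintype.card T : ℝ) ≤ Fintype.card J * Fintype.card T') (β : Finset J)
    (x y : J → T) : 0 ≤ excessDens T' β x y := by
  have := excess_coeff_nonneg ht hT
  have h1 := patDens_nonneg ht none x y
  have h2 : 0 ≤ ∑ j, patDens (some j) x y := sum_nonneg fun j _ => patDens_nonneg ht _ x y
  unfold excessDens
  positivity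

theorem expect_excessDens (ht : 2 ≤ Fintype.card T) (β : Finset J) (x : J → T) :
    𝔼 y, excessDens T' β x y = (Fintype.card J : ℝ) / Fintype.card T -
      1 / (Fintype.card T' : ℝ) + #βᶜ / ((Fintype.card J : ℝ) * Fintype.card T') +
      (Fintype.card J : ℝ) ^ 2 / (Fintype.card T : ℝ) ^ 2 := by
  simp only [excessDens, expect_add_distrib, ← mul_expect, expect_patDens ht, expect_sum_comm]
  simp only [sum_const, card_univ, nsmul_eq_mul, mul_one]
  ring

theorem readDens_nonneg (ht : 2 ≤ Fintype.card T) (β : Finset J) (x y : J → T) :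
    0 ≤ readDens T' β x y := by
  have h1 := patDens_nonneg ht none x y
  have h2 := plantDens_nonneg ht β x y
  have ht' : (1 : ℝ) ≤ Fintype.card T' := by exact_mod_cast Fintype.card_pos
  have h3 : 0 ≤ 1 - 1 / (Fintype.card T' : ℝ) := by
    rw [sub_nonneg, div_le_one (by linarith)]
    exact ht'
  unfold readDens
  positivity

theorem expect_readDens (ht : 2 ≤ Fintype.card T) (β : Finset J) (x : J → T) :
    𝔼 y, readDens T' β x y = 1 := by
  simp only [readDens, expect_add_distrib, ← mul_expect, expect_patDens ht, expect_plantDens ht]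
  ring

/-- Planting at a given position has weight at most `1 / (|J| * t') ≤ 1 / t`, close to the natural
probability of agreement there alone. This is why `t'` is about `t / |J|`; Bernoulli's inequality
bounds the remaining excess. -/
theorem readDens_le (ht : 2 ≤ Fintype.card T)
    (hT : (Fintype.card T : ℝ) ≤ Fintype.card J * Fintype.card T') (β : Finset J)
    (x y : J → T) : readDens T' β x y ≤ 1 + excessDens T' β x y := by
  have h1 := patterns_le_one ht x y
  have h2 : (2 : ℝ) ≤ Fintype.card T := by exact_mod_cast ht
  have ht' : (0 : ℝ) < Fintype.card T' := by exact_mod_cast Fintype.card_pos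
  have hJ0 : (0 : ℝ) < Fintype.card J := by exact_mod_cast Fintype.card_pos
  have hp : 0 ≤ patDens none x y := patDens_nonneg ht _ x y
  set N := patDens none x y
  have hPβ : ∑ j ∈ β, patDens (some j) x y ≤ ∑ j, patDens (some j) x y :=
    sum_le_sum_of_subset_of_nonneg (subset_univ _) fun j _ _ => patDens_nonneg ht _ x y
  have hP : 0 ≤ ∑ j, patDens (some j) x y := sum_nonneg fun j _ => patDens_nonneg ht _ x y
  set W := ∑ j, patDens (some j) x y
  set t : ℝ := (Fintype.card T : ℝ)
  set t' : ℝ := (Fintype.card T' : ℝ)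
  set ℓ : ℝ := (Fintype.card J : ℝ) with hℓ
  have hb1 : 1 - ℓ / t ≤ (1 - 1 / t) ^ Fintype.card J := by
    have := one_add_mul_le_pow (a := -(1 / t)) (by
      have : 1 / t ≤ 1 := by rw [div_le_one (by linarith)]; linarith
      linarith) (Fintype.card J)
    rw [← sub_eq_add_neg] at this
    refine le_trans (le_of_eq ?_) this
    rw [hℓ]; ring
  have hb2 : 1 - ℓ / t ≤ (1 - 1 / t) ^ (Fintype.card J - 1) := by
    refine hb1.trans (pow_le_pow_of_le_one ?_ ?_ (Nat.sub_le _ _))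
    · rw [sub_nonneg, div_le_one (by linarith)]
      linarith
    · rw [sub_le_self_iff]
      positivity
  have h3 : readDens T' β x y ≤ (1 / t') * ((W + #βᶜ * N) / ℓ) + (1 - 1 / t') * N := by
    rw [readDens, plantDens_eq]
    gcongr
  have h4 : (1 / t') * ((W + #βᶜ * N) / ℓ) = (1 / (ℓ * t')) * W + #βᶜ / (ℓ * t') * N := by
    field_simp
  have h5 : 1 / (ℓ * t') ≤ 1 / t := one_div_le_one_div_of_le (by linarith) hT
  have h6 : (1 - ℓ / t) * N ≤ (1 - 1 / t) ^ Fintype.card J * N := by gcongr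
  have h7 : (1 - ℓ / t) / t * W ≤ (1 - 1 / t) ^ (Fintype.card J - 1) / t * W := by gcongr
  have h8 : 1 / (ℓ * t') * W ≤ 1 / t * W := by gcongr
  have h9 : (1 - ℓ / t) / t * W = 1 / t * W - ℓ / t ^ 2 * W := by
    have : t ≠ 0 := by linarith
    field_simp
  change _ ≤ 1 + ((ℓ / t - 1 / t' + #βᶜ / (ℓ * t')) * N + ℓ / t ^ 2 * W)
  nlinarith

/-- The planted letter is uniform and so equals the fixed `v` with probability `1 / t'`; otherwise
the word read avoids `x`. -/
theorem expect_kern_mul_read (ht : 2 ≤ Fintype.card T) (β : Finset J) (x : J → T) (v : T')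
    (F : (J → T) → ℝ) :
    𝔼 a : T' × (T' → J → T), kern β x a * F (a.2 v) = 𝔼 y, readDens T' β x y * F y := by
  rw [expect_prod_type]
  have h1 : ∀ u : T', 𝔼 g : T' → J → T, kern β x (u, g) * F (g v) =
      𝔼 y, (if v = u then plantDens β x y else patDens none x y) * F y := fun u => by
    refine expect_pi_prod_mul
      (fun w y => if w = u then plantDens β x y else patDens none x y) (fun w => ?_) v F
    split_ifs
    exacts [expect_plantDens ht _ _, expect_patDens ht _ _]
  simp only [h1]
  rw [expect_swap]
  refine expect_congr rfl fun y _ => ?_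
  rw [← expect_mul]
  congr 1
  have : ∀ u : T', (if v = u then plantDens β x y else patDens none x y) =
      patDens none x y + if v = u then (plantDens β x y - patDens none x y) else 0 := fun u => by
    split_ifs <;> ring
  simp only [this]
  rw [expect_add_distrib, Fintype.expect_const, Fintype.expect_eq_sum_div_card, sum_ite_eq,
    if_pos (mem_univ _), readDens]
  ring

/-- Planting fails exactly when the random position falls outside `β`. -/
theorem expect_kern_mul_defect (ht : 2 ≤ Fintype.card T) (β : Finset J) (x : J → T) :
    𝔼 a : T' × (T' → J → T), kern β x a * (if ∃ j, x j = a.2 a.1 j then 0 else 1) =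
      #βᶜ / (Fintype.card J : ℝ) := by
  rw [expect_prod_type]
  refine (expect_congr rfl fun u _ => ?_).trans (Fintype.expect_const _)
  have h1 : 𝔼 g : T' → J → T, kern β x (u, g) * (if ∃ j, x j = g u j then (0 : ℝ) else 1) =
      𝔼 y, plantDens β x y * (if ∃ j, x j = y j then (0 : ℝ) else 1) := by
    refine (expect_pi_prod_mul
      (fun w y => if w = u then plantDens β x y else patDens none x y) (fun w => ?_) u
        (fun y => if ∃ j, x j = y j then (0 : ℝ) else 1)).trans ?_
    · split_ifs
      exacts [expect_plantDens ht _ _, expect_patDens ht _ _]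
    · simp
  change 𝔼 g : T' → J → T, kern β x (u, g) * (if ∃ j, x j = g u j then (0 : ℝ) else 1) = _
  rw [h1]
  have h2 : ∀ y, plantDens β x y * (if ∃ j, x j = y j then (0 : ℝ) else 1) =
      #βᶜ / (Fintype.card J : ℝ) * patDens none x y := fun y => by
    by_cases h : ∃ j, x j = y j
    · obtain ⟨j, hj⟩ := h
      rw [if_pos ⟨j, hj⟩, patDens_none_eq_zero hj.symm]
      simp
    · rw [if_neg h, plantDens_eq, sum_eq_zero fun j _ => patDens_some_eq_zero fun hj =>
        h ⟨j, hj.symm⟩]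
      ring
  simp only [h2]
  rw [← mul_expect, expect_patDens ht, mul_one]

end Receiver

/-! ### Pushing product densities forward -/

section Pushforward

variable {Γ Ω : Type*} [Fintype Γ] [Fintype Ω]

theorem expect_prod_mul_comp : ∀ (m : ℕ) (φ : Fin m → Γ → ℝ) (π : Fin m → Γ → Ω)
    (k : Fin m → Ω → ℝ) (_ : ∀ i (F : Ω → ℝ), 𝔼 a, φ i a * F (π i a) = 𝔼 y, k i y * F y)
    (G : (Fin m → Ω) → ℝ),
    𝔼 a : Fin m → Γ, (∏ i, φ i (a i)) * G (fun i => π i (a i)) =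
      𝔼 y : Fin m → Ω, (∏ i, k i (y i)) * G y := by
  intro m
  induction m with
  | zero =>
    intro φ π k h G
    simp only [univ_eq_empty, prod_empty, one_mul]
    rw [Fintype.expect_eq_sum_div_card, Fintype.expect_eq_sum_div_card]
    simp [Subsingleton.elim _ (default : Fin 0 → Ω)]
  | succ m ih =>
    intro φ π k h G
    rw [expect_fin_cons, expect_fin_cons]
    have hc : ∀ (a₀ : Γ) (as : Fin m → Γ), (fun i => π i ((Fin.cons a₀ as : Fin (m + 1) → Γ) i)) =
        Fin.cons (π 0 a₀) (fun i : Fin m => π i.succ (as i)) := fun a₀ as => by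
      funext i
      refine Fin.cases ?_ (fun i => ?_) i <;> simp
    simp only [Fin.prod_univ_succ, Fin.cons_zero, Fin.cons_succ, hc, mul_assoc, ← mul_expect]
    have h1 := fun a₀ => ih (fun i => φ i.succ) (fun i => π i.succ) (fun i => k i.succ)
      (fun i => h i.succ) (fun ys => G (Fin.cons (π 0 a₀) ys))
    simp only [h1]
    exact h 0 fun y₀ => 𝔼 ys : Fin m → Ω, (∏ i : Fin m, k i.succ (ys i)) * G (Fin.cons y₀ ys)

end Pushforward

/-! ### Embedding a small instance with one input confined to a set -/

section Embedding

variable {J T T' : Type} [Fintype J] [Fintype T] [Fintype T'] [DecidableEq J] [DecidableEq T]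
  [DecidableEq T'] {m : ℕ}

/-- Indicates that the exists-equal function differs on `(x, y)` and `(u, v)`. -/
noncomputable def mismatch (x y : Fin m → J → T) (u v : Fin m → T') : ℝ :=
  if ((∃ i j, x i j = y i j) ↔ ∃ i, u i = v i) then 0 else 1

theorem mismatch_nonneg (x y : Fin m → J → T) (u v : Fin m → T') : 0 ≤ mismatch x y u v := by
  unfold mismatch
  split_ifs <;> norm_num

/-- The cost of answering `(u, v)`, for random `v`, by a protocol on `(x, fun i => g i (v i))`. -/
noncomputable def embedCost (e : (Fin m → J → T) → (Fin m → J → T) → ℝ)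
    (g : Fin m → T' → J → T) (u : Fin m → T') (x : Fin m → J → T) : ℝ :=
  𝔼 v : Fin m → T', (e x (fun i => g i (v i)) + mismatch x (fun i => g i (v i)) u v)

theorem expect_eq_boole [Nonempty T'] (i : Fin m) (b : T') :
    𝔼 v : Fin m → T', (if v i = b then (1 : ℝ) else 0) = 1 / Fintype.card T' := by
  have := expect_pi_prod_mul (ι := Fin m) (fun _ (_ : T') => (1 : ℝ))
    (fun _ => Fintype.expect_const _) i fun a => if a = b then (1 : ℝ) else 0
  simp only [prod_const_one, one_mul] at this
  rw [this, Fintype.expect_eq_sum_div_card]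
  simp

/-- Changing `u i` affects the existence of an agreement only if `v i` is the old or the new letter,
an event of probability at most `2 / t'` for uniform `v`. -/
theorem mismatch_update_le (x y : Fin m → J → T) (u v : Fin m → T') (i : Fin m) (b : T') :
    mismatch x y u v ≤ mismatch x y (Function.update u i b) v +
      ((if v i = u i then 1 else 0) + (if v i = b then 1 else 0)) := by
  by_cases h1 : v i = u i
  · have h2 := mismatch_nonneg x y (Function.update u i b) v
    have h3 : mismatch x y u v ≤ 1 := by unfold mismatch; split_ifs <;> norm_num
    have h4 : (0 : ℝ) ≤ if v i = b then 1 else 0 := by split_ifs <;> norm_num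
    simp only [h1, if_true]
    rw [h1] at h4
    linarith
  by_cases h2 : v i = b
  · have h2' := mismatch_nonneg x y (Function.update u i b) v
    have h3 : mismatch x y u v ≤ 1 := by unfold mismatch; split_ifs <;> norm_num
    simp only [h2, if_true]
    have h4 : (0 : ℝ) ≤ if b = u i then 1 else 0 := by split_ifs <;> norm_num
    linarith
  · have : (∃ k, u k = v k) ↔ ∃ k, Function.update u i b k = v k := by
      constructor
      · rintro ⟨k, hk⟩
        have : k ≠ i := by rintro rfl; exact h1 hk.symm
        exact ⟨k, by rwa [Function.update_of_ne this]⟩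
      · rintro ⟨k, hk⟩
        have : k ≠ i := by
          rintro rfl
          rw [Function.update_self] at hk
          exact h2 hk.symm
        exact ⟨k, by rwa [Function.update_of_ne this] at hk⟩
    simp [mismatch, this, h1, h2]

theorem embedCost_update_le [Nonempty T'] (e : (Fin m → J → T) → (Fin m → J → T) → ℝ)
    (g : Fin m → T' → J → T) (x : Fin m → J → T) (u : Fin m → T') (i : Fin m) (b : T') :
    embedCost e g u x ≤ embedCost e g (Function.update u i b) x + 2 / Fintype.card T' := by
  have h : ∀ v : Fin m → T', e x (fun i => g i (v i)) + mismatch x (fun i => g i (v i)) u v ≤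
      (e x (fun i => g i (v i)) +
        mismatch x (fun i => g i (v i)) (Function.update u i b) v) +
      ((if v i = u i then 1 else 0) + (if v i = b then 1 else 0)) := fun v => by
    have := mismatch_update_le x (fun i => g i (v i)) u v i b
    linarith
  refine (expect_mono h).trans_eq ?_
  rw [expect_add_distrib,
    expect_add_distrib univ (fun v : Fin m → T' => if v i = u i then (1 : ℝ) else 0),
    expect_eq_boole, expect_eq_boole, embedCost]
  ring

/-- The cost of embedding at the planted letters. -/
theorem prod_kern_mul_mismatch_le [Nonempty T'] (ht : 2 ≤ Fintype.card T) (β : Fin m → Finset J)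
    (x : Fin m → J → T) (a : Fin m → T' × (T' → J → T)) :
    (∏ i, kern (β i) (x i) (a i)) *
      𝔼 v : Fin m → T', mismatch x (fun i => (a i).2 (v i)) (fun i => (a i).1) v ≤
    ∑ i, 1 / (Fintype.card T' : ℝ) * ((∏ i, kern (β i) (x i) (a i)) *
      (if ∃ j, x i j = (a i).2 (a i).1 j then 0 else 1)) := by
  by_cases h0 : ∏ i, kern (β i) (x i) (a i) = 0
  · simp [h0]
  have hpos : 0 ≤ ∏ i, kern (β i) (x i) (a i) := prod_nonneg fun i _ => kern_nonneg ht _ _ _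
  -- Where the density does not vanish, unplanted words avoid `x`. A mismatch therefore requires `v
  -- i` to be the planted letter of a block whose planting failed.
  have hav : ∀ i w, w ≠ (a i).1 → ∀ j, x i j ≠ (a i).2 w j := by
    intro i w hw j hj
    apply h0
    refine prod_eq_zero (mem_univ i) (prod_eq_zero (mem_univ w) ?_)
    rw [if_neg hw]
    exact patDens_none_eq_zero hj.symm
  have hpt : ∀ v : Fin m → T', mismatch x (fun i => (a i).2 (v i)) (fun i => (a i).1) v ≤
      ∑ i, (if v i = (a i).1 then (1 : ℝ) else 0) *
        (if ∃ j, x i j = (a i).2 (a i).1 j then 0 else 1) := by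
    intro v
    have hnn : ∀ i, (0 : ℝ) ≤ (if v i = (a i).1 then (1 : ℝ) else 0) *
        (if ∃ j, x i j = (a i).2 (a i).1 j then 0 else 1) := fun i => by
      split_ifs <;> norm_num
    by_cases h : ∃ i, v i = (a i).1 ∧ ¬ ∃ j, x i j = (a i).2 (a i).1 j
    · obtain ⟨i, h1, h2⟩ := h
      have h3 := single_le_sum (f := fun i => (if v i = (a i).1 then (1 : ℝ) else 0) *
        (if ∃ j, x i j = (a i).2 (a i).1 j then 0 else 1)) (fun i _ => hnn i) (mem_univ i)
      rw [if_pos h1, if_neg h2, one_mul] at h3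
      refine le_trans ?_ h3
      unfold mismatch
      split_ifs <;> norm_num
    · push Not at h
      have : (∃ i j, x i j = (a i).2 (v i) j) ↔ ∃ i, (a i).1 = v i := by
        constructor
        · rintro ⟨i, j, hj⟩
          refine ⟨i, ?_⟩
          by_contra hne
          exact hav i (v i) (Ne.symm hne) j hj
        · rintro ⟨i, hi⟩
          obtain ⟨j, hj⟩ := h i hi.symm
          exact ⟨i, j, by rw [← hi]; exact hj⟩
      unfold mismatch
      rw [if_pos this]
      exact sum_nonneg fun i _ => hnn i
  refine (mul_le_mul_of_nonneg_left (expect_mono hpt) hpos).trans_eq ?_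
  rw [expect_sum_comm, mul_sum]
  refine sum_congr rfl fun i _ => ?_
  rw [← expect_mul, expect_eq_boole]
  ring

/-- For each fixed `v` the receiver's input is nearly uniform. A position outside `β` is charged
twice, for the excess of the read density and for failed planting; hence the factor `2`. -/
theorem expect_prod_kern_mul_cost_le [Nonempty J] [Nonempty T'] (ht : 2 ≤ Fintype.card T)
    (hT : (Fintype.card T : ℝ) ≤ Fintype.card J * Fintype.card T')
    (e : (Fin m → J → T) → (Fin m → J → T) → ℝ) (he0 : ∀ x y, 0 ≤ e x y)
    (he1 : ∀ x y, e x y ≤ 1) (β : Fin m → Finset J) (x : Fin m → J → T) :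
    𝔼 a : Fin m → T' × (T' → J → T), (∏ i, kern (β i) (x i) (a i)) *
      embedCost e (fun i => (a i).2) (fun i => (a i).1) x ≤
    𝔼 y, e x y + (m * ((Fintype.card J : ℝ) / Fintype.card T - 1 / (Fintype.card T' : ℝ) +
      (Fintype.card J : ℝ) ^ 2 / (Fintype.card T : ℝ) ^ 2) +
      2 / ((Fintype.card J : ℝ) * Fintype.card T') * ∑ i, (#(β i)ᶜ : ℝ)) := by
  have : Nonempty T := Fintype.card_pos_iff.1 (by omega)
  have hsplit : ∀ a : Fin m → T' × (T' → J → T), (∏ i, kern (β i) (x i) (a i)) *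
      embedCost e (fun i => (a i).2) (fun i => (a i).1) x =
      (𝔼 v : Fin m → T', (∏ i, kern (β i) (x i) (a i)) * e x (fun i => (a i).2 (v i))) +
      (∏ i, kern (β i) (x i) (a i)) *
        𝔼 v : Fin m → T', mismatch x (fun i => (a i).2 (v i)) (fun i => (a i).1) v := fun a => by
    rw [embedCost, expect_add_distrib, mul_add, mul_expect]
  simp only [hsplit]
  rw [expect_add_distrib]
  have h1 : 𝔼 a : Fin m → T' × (T' → J → T), 𝔼 v : Fin m → T',
      (∏ i, kern (β i) (x i) (a i)) * e x (fun i => (a i).2 (v i)) ≤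
      𝔼 y, e x y + ∑ i, 𝔼 w, excessDens T' (β i) (x i) w := by
    rw [expect_swap]
    refine expect_le univ_nonempty fun v _ => ?_
    rw [expect_prod_mul_comp m (fun i a => kern (β i) (x i) a) (fun i a => a.2 (v i))
      (fun i y => readDens T' (β i) (x i) y)
      (fun i F => expect_kern_mul_read ht (β i) (x i) (v i) F) (fun y => e x y)]
    simp only [mul_comm (∏ i, _)]
    exact expect_mul_prod_le m _ _ _ (fun i y => readDens_nonneg ht _ _ _)
      (fun i => expect_readDens ht _ _) (fun i y => readDens_le ht hT _ _ _)
      (fun i y => excessDens_nonneg ht hT _ _ _) (he0 x) (he1 x)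
  have h2 := expect_mono fun a : Fin m → T' × (T' → J → T) =>
    prod_kern_mul_mismatch_le ht β x a
  have h3 : ∀ i, 𝔼 a : Fin m → T' × (T' → J → T), (∏ i, kern (β i) (x i) (a i)) *
      (if ∃ j, x i j = (a i).2 (a i).1 j then (0 : ℝ) else 1) =
      #(β i)ᶜ / (Fintype.card J : ℝ) := fun i => by
    rw [← expect_kern_mul_defect (T' := T') ht (β i) (x i)]
    exact expect_pi_prod_mul (fun i a => kern (β i) (x i) a) (fun i => expect_kern ht _ _) i
      fun a => if ∃ j, x i j = a.2 a.1 j then (0 : ℝ) else 1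
  rw [expect_sum_comm] at h2
  simp only [← mul_expect, h3] at h2
  simp only [expect_excessDens ht] at h1
  refine (add_le_add h1 h2).trans_eq ?_
  rw [add_assoc, ← sum_add_distrib, mul_sum]
  congr 1
  have h4 : (m : ℝ) * ((Fintype.card J : ℝ) / Fintype.card T - 1 / (Fintype.card T' : ℝ) +
      (Fintype.card J : ℝ) ^ 2 / (Fintype.card T : ℝ) ^ 2) =
      ∑ _i : Fin m, ((Fintype.card J : ℝ) / Fintype.card T - 1 / (Fintype.card T' : ℝ) +
      (Fintype.card J : ℝ) ^ 2 / (Fintype.card T : ℝ) ^ 2) := by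
    rw [sum_const, card_univ, Fintype.card_fin, nsmul_eq_mul]
  rw [h4, ← sum_add_distrib]
  refine sum_congr rfl fun i _ => ?_
  have ht' : (Fintype.card T' : ℝ) ≠ 0 := by exact_mod_cast Fintype.card_ne_zero
  have hJ0 : (Fintype.card J : ℝ) ≠ 0 := by exact_mod_cast Fintype.card_ne_zero
  field_simp
  ring

/-- The density of the uniform distribution on `S`. -/
noncomputable def unifDens {X : Type*} [Fintype X] [DecidableEq X] (S : Finset X) (x : X) : ℝ :=
  if x ∈ S then (Fintype.card X : ℝ) / #S else 0

theorem unifDens_nonneg {X : Type*} [Fintype X] [DecidableEq X] (S : Finset X) (x : X) :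
    0 ≤ unifDens S x := by
  unfold unifDens
  split_ifs <;> positivity

theorem expect_unifDens_mul {X : Type*} [Fintype X] [DecidableEq X] {S : Finset X}
    (hS : S.Nonempty) (f : X → ℝ) : 𝔼 x, unifDens S x * f x = 𝔼 x ∈ S, f x := by
  obtain ⟨x₀, _⟩ := hS
  have : (Fintype.card X : ℝ) ≠ 0 := by
    have : Nonempty X := ⟨x₀⟩
    exact_mod_cast Fintype.card_ne_zero
  rw [Fintype.expect_eq_sum_div_card, expect_eq_sum_div_card]
  simp only [unifDens, ite_mul, zero_mul, sum_ite_mem, univ_inter]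
  rw [← mul_sum]
  field_simp

theorem expect_unifDens {X : Type*} [Fintype X] [DecidableEq X] {S : Finset X}
    (hS : S.Nonempty) : 𝔼 x, unifDens S x = 1 := by
  have := expect_unifDens_mul hS fun _ => 1
  simpa [expect_const hS] using this

theorem relEnt_unifDens {X : Type*} [Fintype X] [DecidableEq X] {S : Finset X}
    (hS : S.Nonempty) : relEnt (unifDens S) = Real.log ((Fintype.card X : ℝ) / #S) := by
  rw [relEnt, expect_unifDens hS, expect_unifDens_mul hS]
  have : ∀ x ∈ S, Real.log (unifDens S x) = Real.log ((Fintype.card X : ℝ) / #S) := fun x hx => by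
    rw [unifDens, if_pos hx]
  rw [expect_congr rfl this, expect_const hS]
  simp

theorem exists_le_of_expect_mul_le {X : Type*} [Fintype X] {Z f : X → ℝ} {c : ℝ}
    (hZ : ∀ a, 0 ≤ Z a) (hZ1 : 𝔼 a, Z a = 1) (h : 𝔼 a, Z a * f a ≤ c) : ∃ a, f a ≤ c := by
  by_contra! hc
  have hpos : 0 < 𝔼 a, Z a * (f a - c) := by
    refine (expect_nonneg' fun a => mul_nonneg (hZ a) (sub_nonneg.2 (hc a).le)).lt_of_ne ?_
    intro h0
    have := (Fintype.expect_eq_zero_iff_of_nonneg (f := fun a => Z a * (f a - c))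
      fun a => mul_nonneg (hZ a) (sub_nonneg.2 (hc a).le)).1 h0.symm
    have hz : ∀ a, Z a = 0 := fun a => by
      have := congrFun this a
      exact (mul_eq_zero.1 this).resolve_right (sub_pos.2 (hc a)).ne'
    simp [hz] at hZ1
  simp only [mul_sub, expect_sub_distrib, ← expect_mul, hZ1] at hpos
  linarith

/-- A small instance of exists-equal can be embedded into a large one in such a way that one player
uses only inputs from a given set `S`. -/
theorem exists_embedding [Nonempty J] [Nonempty T'] (ht : 2 ≤ Fintype.card T)
    (hT : (Fintype.card T : ℝ) ≤ Fintype.card J * Fintype.card T')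
    (hT2 : (Fintype.card J : ℝ) * Fintype.card T' ≤ 2 * Fintype.card T)
    (hJT : Fintype.card J ≤ Fintype.card T) {K lam : ℝ} (hK : 1 < K) (hlam : 0 < lam)
    (hlam1 : lam ≤ 1)
    (e : (Fin m → J → T) → (Fin m → J → T) → ℝ) (he0 : ∀ x y, 0 ≤ e x y)
    (he1 : ∀ x y, e x y ≤ 1) (S : Finset (Fin m → J → T)) (hS : S.Nonempty) :
    ∃ (X : (Fin m → T') → Fin m → J → T) (Y : (Fin m → T') → Fin m → J → T),
      (∀ u, X u ∈ S) ∧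
      𝔼 u, 𝔼 v, (e (X u) (Y v) + mismatch (X u) (Y v) u v) ≤
        𝔼 x ∈ S, 𝔼 y, e x y +
        m * ((Fintype.card J : ℝ) / Fintype.card T - 1 / (Fintype.card T' : ℝ) +
          (Fintype.card J : ℝ) ^ 2 / (Fintype.card T : ℝ) ^ 2) +
        2 / ((Fintype.card J : ℝ) * Fintype.card T') * ((Real.log K)⁻¹ *
          Real.log (Fintype.card (Fin m → J → T) / #S) + Fintype.card J * (Real.log K)⁻¹ * m) +
        2 / (lam * Fintype.card T') * (216 * (Real.log K)⁻¹ / Fintype.card J *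
          Real.log (Fintype.card (Fin m → J → T) / #S) +
          (279 * (K / Fintype.card J) + 216 * (Real.log K)⁻¹) * m + lam ^ 2 * m) := by
  have ht' : (0 : ℝ) < Fintype.card T' := by exact_mod_cast Fintype.card_pos
  have hJ0 : (0 : ℝ) < Fintype.card J := by exact_mod_cast Fintype.card_pos
  set ρ := unifDens S with hρ
  have hρ1 : 𝔼 x, ρ x = 1 := expect_unifDens hS
  obtain ⟨β, hbad, hent⟩ := exists_labelling_of_block (Γ := T' × (T' → J → T))
    (fun (b : Finset J) (x : J → T) a => kern b x a) (fun b x a => kern_nonneg ht b x a)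
    (fun b x => expect_kern ht b x) (fun b => (#bᶜ : ℝ)) _ _ _ _
    (fun ρ hρ => exists_block_labelling ht hT2 hJT hK ρ hρ) m ρ (unifDens_nonneg S)
  rw [hρ1, mul_one, hρ, relEnt_unifDens hS, ← hρ] at hbad hent
  set Df := Real.log (Fintype.card (Fin m → J → T) / #S)
  set Z : (Fin m → T' × (T' → J → T)) → ℝ := fun a => 𝔼 x, ρ x * ∏ i, kern (β x i) (x i) (a i)
    with hZ
  have hZ0 : ∀ a, 0 ≤ Z a := fun a => expect_nonneg' fun x =>
    mul_nonneg (unifDens_nonneg S x) (prod_nonneg fun i _ => kern_nonneg ht _ _ _)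
  have hZ1 : 𝔼 a, Z a = 1 := by
    simp only [hZ]
    rw [expect_swap, ← hρ1]
    refine expect_congr rfl fun x _ => ?_
    rw [← mul_expect, expect_pi_prod fun i a => kern (β x i) (x i) a]
    simp [expect_kern ht]
  -- The least cost over `S` forgets the planted `x`, so it makes sense for uniform `(u, g)`, and it
  -- inherits the Lipschitz bound from each single cost.
  set f : (Fin m → T' → J → T) → (Fin m → T') → ℝ := fun g u =>
    S.inf' hS (embedCost e g u) with hf
  set c : ℝ := 2 / Fintype.card T' with hc
  have hc0 : 0 < c := by positivity
  set s : ℝ := lam / c with hs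
  have hs0 : 0 < s := by positivity
  have hsc : s * c = lam := by rw [hs]; field_simp
  have hlip : ∀ g u i b, f g u ≤ f g (Function.update u i b) + c := by
    intro g u i b
    obtain ⟨x, hx, hxe⟩ := exists_mem_eq_inf' hS (embedCost e g (Function.update u i b))
    simp only [hf]
    rw [hxe]
    exact (inf'_le _ hx).trans (embedCost_update_le e g x u i b)
  -- Under the uniform law `u` is independent of `g`, so bounded differences apply with `g` fixed.
  have hmgf : 𝔼 a : Fin m → T' × (T' → J → T), Real.exp (s * (𝔼 w, f (fun i => (a i).2) w -
      f (fun i => (a i).2) (fun i => (a i).1))) ≤ Real.exp (lam ^ 2 * m) := by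
    refine (Fintype.expect_equiv
      (Equiv.arrowProdEquivProdArrow (Fin m) (fun _ => T') fun _ => T' → J → T) _
      (fun p => Real.exp (s * (𝔼 w, f p.2 w - f p.2 p.1))) (fun a => rfl)).trans_le ?_
    rw [expect_prod_type, expect_swap]
    have : Nonempty T := Fintype.card_pos_iff.1 (by omega)
    refine expect_le univ_nonempty fun g _ => ?_
    refine (exp_expect_sub_le_of_lipschitz hs0.le (hsc.trans_le hlam1) m (f g)
      (hlip g)).trans_eq ?_
    rw [← mul_pow, hsc]
  have hDV := expect_mul_le_relEnt (f := Z) (Φ := fun a => s * (𝔼 w, f (fun i => (a i).2) w -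
      f (fun i => (a i).2) (fun i => (a i).1))) hZ0
  rw [hZ1, one_mul] at hDV
  have : Nonempty T := Fintype.card_pos_iff.1 (by omega)
  have hlog : Real.log (𝔼 a : Fin m → T' × (T' → J → T),
      Real.exp (s * (𝔼 w, f (fun i => (a i).2) w -
      f (fun i => (a i).2) (fun i => (a i).1)))) ≤ lam ^ 2 * m := by
    rw [Real.log_le_iff_le_exp (expect_pos (fun _ _ => Real.exp_pos _) univ_nonempty)]
    exact hmgf
  -- Under the planted law the drawn `x` lies in `S` and competes in the minimum.
  have hplant : 𝔼 a, Z a * f (fun i => (a i).2) (fun i => (a i).1) ≤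
      𝔼 x ∈ S, 𝔼 y, e x y +
        (m * ((Fintype.card J : ℝ) / Fintype.card T - 1 / (Fintype.card T' : ℝ) +
          (Fintype.card J : ℝ) ^ 2 / (Fintype.card T : ℝ) ^ 2) +
        2 / ((Fintype.card J : ℝ) * Fintype.card T') * ((Real.log K)⁻¹ * Df +
          Fintype.card J * (Real.log K)⁻¹ * m)) := by
    have h1 : ∀ x, 𝔼 a : Fin m → T' × (T' → J → T), ρ x * (∏ i, kern (β x i) (x i) (a i)) *
        f (fun i => (a i).2) (fun i => (a i).1) ≤ ρ x * (𝔼 y, e x y +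
        (m * ((Fintype.card J : ℝ) / Fintype.card T - 1 / (Fintype.card T' : ℝ) +
      (Fintype.card J : ℝ) ^ 2 / (Fintype.card T : ℝ) ^ 2) +
      2 / ((Fintype.card J : ℝ) * Fintype.card T') * ∑ i, (#(β x i)ᶜ : ℝ))) := by
      intro x
      by_cases hx : x ∈ S
      · refine le_trans ?_ (mul_le_mul_of_nonneg_left
          (expect_prod_kern_mul_cost_le ht hT e he0 he1 (β x) x) (unifDens_nonneg S x))
        rw [mul_expect]
        refine expect_mono fun a => ?_
        rw [mul_assoc]
        refine mul_le_mul_of_nonneg_left (mul_le_mul_of_nonneg_left (inf'_le _ hx)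
          (prod_nonneg fun i _ => kern_nonneg ht _ _ _)) (unifDens_nonneg S x)
      · have : ρ x = 0 := by rw [hρ, unifDens, if_neg hx]
        simp [this]
    have h2 : 𝔼 a, Z a * f (fun i => (a i).2) (fun i => (a i).1) =
        𝔼 x, 𝔼 a : Fin m → T' × (T' → J → T), ρ x * (∏ i, kern (β x i) (x i) (a i)) *
        f (fun i => (a i).2) (fun i => (a i).1) := by
      rw [expect_swap]
      refine expect_congr rfl fun a _ => ?_
      rw [← expect_mul]
    rw [h2]
    refine (expect_mono h1).trans ?_
    simp only [mul_add, expect_add_distrib]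
    rw [← mul_add, hρ, expect_unifDens_mul hS, ← hρ]
    simp only [← expect_mul, hρ1, one_mul]
    have h3 : 𝔼 x, ρ x * (2 / ((Fintype.card J : ℝ) * Fintype.card T') * ∑ i, (#(β x i)ᶜ : ℝ)) =
        2 / ((Fintype.card J : ℝ) * Fintype.card T') * 𝔼 x, ρ x * ∑ i, (#(β x i)ᶜ : ℝ) := by
      rw [mul_expect]
      exact expect_congr rfl fun x _ => by ring
    rw [h3]
    have h4 := mul_le_mul_of_nonneg_left hbad
      (show 0 ≤ 2 / ((Fintype.card J : ℝ) * Fintype.card T') by positivity)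
    linarith
  have hexp : 𝔼 a, Z a * (s * (𝔼 w, f (fun i => (a i).2) w -
      f (fun i => (a i).2) (fun i => (a i).1))) =
      s * (𝔼 a, Z a * 𝔼 w, f (fun i => (a i).2) w -
        𝔼 a, Z a * f (fun i => (a i).2) (fun i => (a i).1)) := by
    rw [← expect_sub_distrib, mul_expect]
    exact expect_congr rfl fun a _ => by ring
  rw [hexp] at hDV
  have hbound : 𝔼 a, Z a * 𝔼 w, f (fun i => (a i).2) w ≤
      𝔼 a, Z a * f (fun i => (a i).2) (fun i => (a i).1) + (216 * (Real.log K)⁻¹ /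
        Fintype.card J * Df +
        (279 * (K / Fintype.card J) + 216 * (Real.log K)⁻¹) * m + lam ^ 2 * m) / s := by
    rw [← sub_le_iff_le_add', le_div_iff₀ hs0]
    linarith
  -- Only the table of `a` is kept; the bound already averages over all `u`.
  obtain ⟨a, ha⟩ := exists_le_of_expect_mul_le hZ0 hZ1 hbound
  choose X hXS hX using fun u => exists_mem_eq_inf' hS (embedCost e (fun i => (a i).2) u)
  refine ⟨X, fun v i => (a i).2 (v i), hXS, ?_⟩
  have h1 : 𝔼 u, 𝔼 v, (e (X u) (fun i => (a i).2 (v i)) +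
      mismatch (X u) (fun i => (a i).2 (v i)) u v) = 𝔼 w, f (fun i => (a i).2) w := by
    refine expect_congr rfl fun u _ => ?_
    simp only [hf, hX u]
    rfl
  rw [h1]
  have h2 : ∀ r : ℝ, r / s = 2 / (lam * Fintype.card T') * r := fun r => by
    rw [hs, hc]
    field_simp
  rw [h2] at ha
  linarith

end Embedding

/-! ### Transforming protocols -/

namespace Protocol

variable {X X' : Type}

/-- The protocol in which the player to move maps the own input by `f`, and the other one by `g`. -/
def comap₂ : (X' → X) → (X' → X) → Protocol X → Protocol X'
  | f, _, output h => output (h ∘ f)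
  | f, g, send msg next => send (msg ∘ f) fun w => comap₂ g f (next w)

theorem run_comap₂ (P : Protocol X) : ∀ (f g : X' → X) (a b : X'),
    (comap₂ f g P).run a b = P.run (f a) (g b) := by
  induction P with
  | output h => intros; rfl
  | send msg next ih =>
    intro f g a b
    simp only [comap₂, run, Function.comp_apply, ih]

theorem messages_comap₂ (P : Protocol X) : ∀ (f g : X' → X) (a b : X'),
    (comap₂ f g P).messages a b = P.messages (f a) (g b) := by
  induction P with
  | output h => intros; rfl
  | send msg next ih =>
    intro f g a b
    simp only [comap₂, messages, Function.comp_apply, ih]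

/-- There are at most `r` messages, and each has fewer than `k` bits. -/
def IsShort (P : Protocol X) (r k : ℕ) : Prop :=
  ∀ a b, (P.messages a b).length ≤ r ∧ ∀ w ∈ P.messages a b, w.length < k

/-- Empty messages carry no information. -/
theorem exists_run_eq_of_isShort_one [Nonempty X] (P : Protocol X) :
    ∀ r, P.IsShort r 1 → ∃ f : X → Bool, (∀ a b, P.run a b = f a) ∨ ∀ a b, P.run a b = f b := by
  induction P with
  | output f => exact fun _ _ => ⟨f, Or.inl fun _ _ => rfl⟩
  | send msg next ih =>
    intro r h
    have hmsg : ∀ a, msg a = [] := fun a => by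
      have := (h a a).2 (msg a) (by simp [messages])
      exact List.length_eq_zero_iff.1 (by omega)
    obtain ⟨f, hf⟩ := ih [] r fun a b => by
      have := h b a
      simp only [messages, hmsg, List.length_cons, List.mem_cons] at this
      exact ⟨by omega, fun w hw => this.2 w (Or.inr hw)⟩
    refine ⟨f, hf.symm.imp (fun hf a b => ?_) fun hf a b => ?_⟩ <;>
      simp only [run, hmsg, hf]

end Protocol

/-- The error of a protocol for the exists-equal function on uniform inputs. -/
noncomputable def unifError {t n : ℕ} (P : Protocol (Vec t n)) : ℝ :=
  𝔼 a, 𝔼 b, if P.run a b = EE a b then 0 else 1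

theorem EE_comm {t n : ℕ} (x y : Vec t n) : EE x y = EE y x := by
  simp only [EE, eq_comm]

/-! ### Guessing without information -/

section ZeroRound

variable {t n : ℕ}

theorem expect_EE_false (ht : 1 ≤ t) (a : Vec t n) :
    𝔼 b, (if EE a b = true then (0 : ℝ) else 1) = (1 - 1 / (t : ℝ)) ^ n := by
  have h1 : ∀ b : Vec t n, (if EE a b = true then (0 : ℝ) else 1) =
      ∏ i, if b i = a i then (0 : ℝ) else 1 := fun b => by
    by_cases h : ∃ i, a i = b i
    · obtain ⟨i, hi⟩ := h
      rw [if_pos (by simpa [EE] using ⟨i, hi⟩)]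
      exact (prod_eq_zero (mem_univ i) (by simp [hi])).symm
    · rw [if_neg (by simpa [EE] using h)]
      refine (prod_eq_one fun i _ => if_neg fun hi => h ⟨i, hi.symm⟩).symm
  simp only [h1]
  rw [expect_pi_prod fun i w => if w = a i then (0 : ℝ) else 1]
  simp only [expect_ite_eq_else, Fintype.card_fin, prod_const, card_univ]
  congr 1
  have : (t : ℝ) ≠ 0 := by positivity
  field_simp

/-- For each input, the probability of no agreement lies between `3 / 4` and `10 / 11`, the latter
from `exp (-1/10) ≤ 1 / (1 + 1/10)`. -/
theorem unifError_guess_ge (hn : 1 ≤ n) (h4 : 4 * n ≤ t) (h10 : t ≤ 10 * n)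
    (f : Vec t n → Bool) :
    1 / 11 ≤ 𝔼 a, 𝔼 b, (if f a = EE a b then (0 : ℝ) else 1) := by
  have ht : 1 ≤ t := by omega
  have : Nonempty (Fin t) := ⟨⟨0, ht⟩⟩
  have hn' : (1 : ℝ) ≤ n := by exact_mod_cast hn
  have h4' : 4 * (n : ℝ) ≤ t := by exact_mod_cast h4
  have h10' : (t : ℝ) ≤ 10 * n := by exact_mod_cast h10
  have ht1 : 1 / (t : ℝ) ≤ 1 := by rw [div_le_one (by linarith)]; linarith
  have hlow : 3 / 4 ≤ (1 - 1 / (t : ℝ)) ^ n := by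
    have := one_add_mul_le_pow (a := -(1 / (t : ℝ))) (by linarith) n
    rw [← sub_eq_add_neg] at this
    refine le_trans ?_ this
    have : (n : ℝ) * (1 / t) ≤ 1 / 4 := by
      rw [mul_one_div, div_le_iff₀ (by linarith)]
      linarith
    linarith
  have hupp : (1 - 1 / (t : ℝ)) ^ n ≤ 10 / 11 := by
    have h1 : 1 - 1 / (t : ℝ) ≤ Real.exp (-(1 / t)) := Real.one_sub_le_exp_neg _
    have h2 : (1 - 1 / (t : ℝ)) ^ n ≤ Real.exp (-(n * (1 / t))) := by
      refine (pow_le_pow_left₀ (by linarith) h1 n).trans_eq ?_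
      rw [← Real.exp_nat_mul]
      congr 1
      ring
    refine h2.trans ?_
    have h3 : 1 / 10 ≤ (n : ℝ) * (1 / t) := by
      rw [mul_one_div, le_div_iff₀ (by linarith)]
      linarith
    have h5 : Real.exp (-(n * (1 / t))) ≤ Real.exp (-(1 / 10)) :=
      Real.exp_le_exp.2 (by linarith)
    refine h5.trans ?_
    rw [Real.exp_neg, inv_le_comm₀ (Real.exp_pos _) (by norm_num)]
    have := Real.add_one_le_exp (1 / 10 : ℝ)
    norm_num at this ⊢
    linarith
  refine le_expect univ_nonempty fun a _ => ?_
  have h0 := expect_EE_false ht a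
  cases hfa : f a
  · have : ∀ b, (if false = EE a b then (0 : ℝ) else 1) =
        1 - (if EE a b = true then (0 : ℝ) else 1) := fun b => by
      cases EE a b <;> simp
    simp only [this]
    rw [expect_sub_distrib, h0, Fintype.expect_const]
    linarith
  · simp only [eq_comm (a := true)]
    rw [h0]
    linarith

theorem unifError_ge_of_isShort_one (hn : 1 ≤ n) (h4 : 4 * n ≤ t) (h10 : t ≤ 10 * n)
    {P : Protocol (Vec t n)} {r : ℕ} (hP : P.IsShort r 1) : 1 / 11 ≤ unifError P := by
  have : Nonempty (Fin t) := ⟨⟨0, by omega⟩⟩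
  obtain ⟨f, hf | hf⟩ := P.exists_run_eq_of_isShort_one r hP
  · simp only [unifError, hf]
    exact unifError_guess_ge hn h4 h10 f
  · simp only [unifError, hf]
    rw [expect_swap]
    simp only [fun a b : Vec t n => EE_comm b a]
    exact unifError_guess_ge hn h4 h10 f

end ZeroRound

/-! ### Selecting a message -/

section ChooseMessage

variable {X M : Type*} [Fintype X] [DecidableEq M]

theorem exists_fiber_expect_le [Nonempty X] (f : X → M) (F : X → ℝ) {c : ℝ}
    (h : 𝔼 x, F x ≤ c) : ∃ x₀, 𝔼 x with f x = f x₀, F x ≤ c := by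
  by_contra! hc
  have hX : (0 : ℝ) < Fintype.card X := by exact_mod_cast Fintype.card_pos
  rw [Fintype.expect_eq_sum_div_card, div_le_iff₀ hX] at h
  have h1 : ∑ w ∈ univ.image f, ∑ x with f x = w, F x = ∑ x, F x :=
    sum_fiberwise_of_maps_to (fun x _ => mem_image_of_mem f (mem_univ x)) F
  have h2 : ∑ w ∈ univ.image f, ∑ x with f x = w, c = ∑ _x : X, c :=
    sum_fiberwise_of_maps_to (fun x _ => mem_image_of_mem f (mem_univ x)) fun _ => c
  have h3 : ∑ w ∈ univ.image f, ∑ x with f x = w, c < ∑ w ∈ univ.image f, ∑ x with f x = w, F x := by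
    refine sum_lt_sum_of_nonempty (univ_nonempty.image f) fun w hw => ?_
    obtain ⟨x₀, _, rfl⟩ := mem_image.1 hw
    have h4 := hc x₀
    have hpos : (0 : ℝ) < #{x | f x = f x₀} := by
      exact_mod_cast card_pos.2 ⟨x₀, by simp⟩
    rw [expect_eq_sum_div_card, lt_div_iff₀ hpos] at h4
    rw [sum_const, nsmul_eq_mul]
    linarith
  rw [h1, h2, sum_const, card_univ, nsmul_eq_mul] at h3
  linarith

/-- The left side is the entropy of `f x`. The tangent of `log` at `N` suffices, because the mean of
`|X| / |fiber|` is the number of values of `f`. -/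
theorem expect_log_fiber_le [Nonempty X] (f : X → M) {N : ℝ} (hN : (#(univ.image f) : ℝ) ≤ N) :
    𝔼 x, Real.log (Fintype.card X / #{x' | f x' = f x}) ≤ Real.log N := by
  have hX : (0 : ℝ) < Fintype.card X := by exact_mod_cast Fintype.card_pos
  have hpos : ∀ x₀, (0 : ℝ) < #{x | f x = f x₀} := fun x₀ => by
    exact_mod_cast card_pos.2 ⟨x₀, by simp⟩
  have hI : (0 : ℝ) < #(univ.image f) := by exact_mod_cast card_pos.2 (univ_nonempty.image f)
  have hN0 : 0 < N := hI.trans_le hN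
  have hpt : ∀ x, Real.log (Fintype.card X / #{x' | f x' = f x}) ≤
      Real.log N - 1 + N⁻¹ * (Fintype.card X / #{x' | f x' = f x}) := fun x => by
    have h1 : 0 < (Fintype.card X : ℝ) / #{x' | f x' = f x} := div_pos hX (hpos x)
    have := Real.log_le_sub_one_of_pos (mul_pos (inv_pos.2 hN0) h1)
    rw [Real.log_mul (inv_pos.2 hN0).ne' h1.ne', Real.log_inv] at this
    linarith
  refine (expect_mono hpt).trans ?_
  rw [expect_add_distrib, Fintype.expect_const, ← mul_expect]
  have hsum : 𝔼 x, (Fintype.card X : ℝ) / #{x' | f x' = f x} = #(univ.image f) := by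
    rw [Fintype.expect_eq_sum_div_card,
      ← sum_fiberwise_of_maps_to (fun x _ => mem_image_of_mem f (mem_univ x))]
    have : ∀ w ∈ univ.image f, ∑ x with f x = w, (Fintype.card X : ℝ) / #{x' | f x' = f x} =
        Fintype.card X := fun w hw => by
      obtain ⟨x₀, _, rfl⟩ := mem_image.1 hw
      have : ∀ x ∈ ({x | f x = f x₀} : Finset X), (Fintype.card X : ℝ) / #{x' | f x' = f x} =
          Fintype.card X / #{x' | f x' = f x₀} := fun x hx => by
        rw [(mem_filter.1 hx).2]
      rw [sum_congr rfl this, sum_const, nsmul_eq_mul, mul_div_cancel₀ _ (hpos x₀).ne']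
    rw [sum_congr rfl this, sum_const, nsmul_eq_mul]
    field_simp
  rw [hsum]
  have : N⁻¹ * (#(univ.image f) : ℝ) ≤ 1 := by
    rw [inv_mul_le_iff₀ hN0, mul_one]
    exact hN
  linarith

theorem card_image_list_le (f : X → List Bool) {k : ℕ} (hf : ∀ x, (f x).length < k) :
    #(univ.image f) ≤ 2 ^ k := by
  have h1 : univ.image f ⊆ (range k).biUnion fun i =>
      (univ : Finset (Fin i → Bool)).image List.ofFn := fun w hw => by
    obtain ⟨x, _, rfl⟩ := mem_image.1 hw
    exact mem_biUnion.2 ⟨(f x).length, mem_range.2 (hf x),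
      mem_image.2 ⟨(f x).get, mem_univ _, List.ofFn_get _⟩⟩
  refine (card_le_card h1).trans (card_biUnion_le.trans ?_)
  have h2 : ∀ i ∈ range k, #((univ : Finset (Fin i → Bool)).image List.ofFn) ≤ 2 ^ i :=
    fun i _ => card_image_le.trans (by simp)
  refine (sum_le_sum h2).trans ?_
  rw [Nat.geomSum_eq le_rfl]
  simp

end ChooseMessage

/-! ### Eliminating one round, then all of them -/

section RoundElimination

/-- Words of `m` blocks of length `ℓ`, as words of length `m * ℓ`. -/
def flatten {t m ℓ : ℕ} : (Fin m → Fin ℓ → Fin t) ≃ Vec t (m * ℓ) :=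
  (Equiv.curry _ _ _).symm.trans (Equiv.arrowCongr finProdFinEquiv (Equiv.refl _))

theorem EE_flatten {t m ℓ : ℕ} (x y : Fin m → Fin ℓ → Fin t) :
    EE (flatten x) (flatten y) = decide (∃ i j, x i j = y i j) := by
  simp only [EE, decide_eq_decide]
  constructor
  · rintro ⟨p, hp⟩
    exact ⟨_, _, hp⟩
  · rintro ⟨i, j, h⟩
    refine ⟨finProdFinEquiv (i, j), ?_⟩
    simpa [flatten] using h

/-- The entropies are `O(η m)` and are divided by `t' ≥ 4 m`. The choice `√η` for the concentration
parameter balances `η / lam` against `lam`; rounding `t'` up accounts for half of `1 / (8 m)`. -/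
theorem embedding_cost_le {m ℓ t t' k L K η : ℝ} (hm : 1 ≤ m) (hℓ : 1 ≤ ℓ) (hk : 0 ≤ k)
    (h4 : 4 * (m * ℓ) ≤ t) (h1 : t ≤ ℓ * t') (h2 : ℓ * t' ≤ t + ℓ) (hη0 : 0 < η) (hη1 : η ≤ 1)
    (hKℓ : K / ℓ ≤ η) (hkL : L * (1 + k / (m * ℓ)) ≤ η) :
    m * (ℓ / t - 1 / t' + ℓ ^ 2 / t ^ 2) + 2 / (ℓ * t') * (L * k + ℓ * L * m) +
      2 / (√η * t') * (216 * L / ℓ * k + (279 * (K / ℓ) + 216 * L) * m + √η ^ 2 * m) ≤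
    249 * √η + 1 / (8 * m) := by
  have hm0 : 0 < m := by linarith
  have hℓ0 : 0 < ℓ := by linarith
  have hmℓ : 0 < m * ℓ := mul_pos hm0 hℓ0
  have ht : 0 < t := by linarith
  have ht'4 : 4 * m ≤ t' := by
    have : ℓ * (4 * m) ≤ ℓ * t' := by linarith
    exact le_of_mul_le_mul_left this hℓ0
  have ht' : 0 < t' := by linarith
  have hs0 : 0 < √η := Real.sqrt_pos.2 hη0
  have hss : √η ^ 2 = η := Real.sq_sqrt hη0.le
  have hηs : η ≤ √η := by
    have : √η ≤ 1 := Real.sqrt_le_one.2 hη1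
    nlinarith
  have hkL' : L * k + ℓ * L * m ≤ η * (m * ℓ) := by
    have := mul_le_mul_of_nonneg_right hkL hmℓ.le
    have e : L * (1 + k / (m * ℓ)) * (m * ℓ) = L * k + ℓ * L * m := by
      field_simp
      ring
    linarith
  have hA : 2 / (ℓ * t') * (L * k + ℓ * L * m) ≤ η / 2 := by
    calc _ ≤ 2 / (ℓ * t') * (η * (m * ℓ)) := by gcongr
      _ = 2 * η * m / t' := by field_simp
      _ ≤ η / 2 := by
        rw [div_le_iff₀ ht']
        nlinarith
  have hB : 216 * L / ℓ * k + (279 * (K / ℓ) + 216 * L) * m + √η ^ 2 * m ≤ 496 * η * m := by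
    have e1 : 216 * L / ℓ * k + 216 * L * m = 216 * ((L * k + ℓ * L * m) / ℓ) := by
      field_simp
    have e2 : (L * k + ℓ * L * m) / ℓ ≤ η * m := by
      rw [div_le_iff₀ hℓ0]
      linarith
    have e3 : K / ℓ * m ≤ η * m := by gcongr
    rw [hss]
    nlinarith
  have hC : 2 / (√η * t') * (216 * L / ℓ * k + (279 * (K / ℓ) + 216 * L) * m + √η ^ 2 * m) ≤
      248 * √η := by
    calc _ ≤ 2 / (√η * t') * (496 * η * m) := by gcongr
      _ = 992 * √η * m / t' := by
        nth_rewrite 2 [← hss]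
        field_simp
        ring
      _ ≤ _ := by
        rw [div_le_iff₀ ht']
        nlinarith
  have hD : m * (ℓ / t - 1 / t' + ℓ ^ 2 / t ^ 2) ≤ 1 / (8 * m) := by
    have e0 : ℓ / t ≤ 1 / (4 * m) := by
      rw [div_le_div_iff₀ ht (by linarith)]
      linarith
    have e1 : ℓ / t - 1 / t' ≤ 1 / (4 * m) * (1 / (4 * m)) := by
      have : ℓ / t - 1 / t' = (ℓ * t' - t) / (t * t') := by field_simp
      rw [this]
      calc (ℓ * t' - t) / (t * t') ≤ ℓ / (t * t') := by gcongr; linarith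
        _ = ℓ / t * (1 / t') := by field_simp
        _ ≤ _ := by gcongr
    have e2 : ℓ ^ 2 / t ^ 2 ≤ 1 / (4 * m) * (1 / (4 * m)) := by
      rw [← div_pow, sq]
      gcongr
    calc _ ≤ m * (1 / (4 * m) * (1 / (4 * m)) + 1 / (4 * m) * (1 / (4 * m))) := by gcongr
      _ = _ := by field_simp; norm_num
  linarith

/-- Eliminating the first message. -/
theorem exists_round_elimination {m ℓ t t' r k : ℕ} {K η : ℝ} (hm : 1 ≤ m) (hℓ : 1 ≤ ℓ)
    (h4 : 4 * (m * ℓ) ≤ t) (h1 : t ≤ ℓ * t') (h2 : ℓ * t' ≤ t + ℓ) (hη0 : 0 < η) (hη1 : η ≤ 1)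
    (hK : 1 < K) (hKℓ : K / ℓ ≤ η) (hkL : 1 + (k : ℝ) / (m * ℓ) ≤ η * Real.log K)
    (msg : Vec t (m * ℓ) → List Bool) (next : List Bool → Protocol (Vec t (m * ℓ)))
    (hP : (Protocol.send msg next).IsShort (r + 1) k) :
    ∃ P' : Protocol (Vec t' m), P'.IsShort r k ∧
      unifError P' ≤ unifError (Protocol.send msg next) + (249 * √η + 1 / (8 * m)) := by
  have hmℓ : 1 ≤ m * ℓ := Nat.mul_pos hm hℓ
  have hℓt : ℓ ≤ t := by nlinarith
  have ht' : 1 ≤ t' := by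
    by_contra h
    have : t' = 0 := by omega
    subst this
    omega
  have : Nonempty (Fin t) := ⟨⟨0, by omega⟩⟩
  have : Nonempty (Fin t') := ⟨⟨0, ht'⟩⟩
  have : Nonempty (Fin ℓ) := ⟨⟨0, hℓ⟩⟩
  have hlog : 0 < Real.log K := Real.log_pos hK
  have hmR : (1 : ℝ) ≤ m := by exact_mod_cast hm
  have hℓR : (1 : ℝ) ≤ ℓ := by exact_mod_cast hℓ
  have h1R : (t : ℝ) ≤ ℓ * t' := by exact_mod_cast h1
  have h2R : (ℓ : ℝ) * t' ≤ t + ℓ := by exact_mod_cast h2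
  have h4R : 4 * ((m : ℝ) * ℓ) ≤ t := by exact_mod_cast h4
  have hℓtR : (ℓ : ℝ) ≤ t := by exact_mod_cast hℓt
  have ht'R : (1 : ℝ) ≤ t' := by exact_mod_cast ht'
  set L : ℝ := (Real.log K)⁻¹ with hL
  have hL0 : 0 ≤ L := inv_nonneg.2 hlog.le
  set X := Fin m → Fin ℓ → Fin t
  set f : X → List Bool := fun x => msg (flatten x) with hf
  set e : List Bool → X → X → ℝ := fun w x y =>
    if (next w).run (flatten y) (flatten x) = EE (flatten x) (flatten y) then 0 else 1 with he
  have he0 : ∀ w x y, 0 ≤ e w x y := fun w x y => by simp only [he]; split_ifs <;> norm_num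
  have he1 : ∀ w x y, e w x y ≤ 1 := fun w x y => by simp only [he]; split_ifs <;> norm_num
  have herr : unifError (Protocol.send msg next) = 𝔼 x, 𝔼 y, e (f x) x y := by
    rw [unifError]
    symm
    refine Fintype.expect_equiv flatten _ _ fun x => ?_
    refine Fintype.expect_equiv flatten _ _ fun y => ?_
    rfl
  have hlen : ∀ x, (f x).length < k := fun x =>
    (hP (flatten x) (flatten x)).2 _ (by simp [Protocol.messages, hf])
  have hN : (#(univ.image f) : ℝ) ≤ 2 ^ k := by exact_mod_cast card_image_list_le f hlen
  have hlogN : 𝔼 x, Real.log (Fintype.card X / #{x' | f x' = f x}) ≤ k := by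
    refine (expect_log_fiber_le f hN).trans ?_
    rw [Real.log_pow]
    exact mul_le_of_le_one_right (Nat.cast_nonneg _) (by linarith [Real.log_two_lt_d9])
  -- `b` is the coefficient of `log (|X| / |S|)` in the cost of the embedding. Averaging error plus
  -- `b` times this deficit selects a message that is good for both at once.
  set b : ℝ := 2 / ((ℓ : ℝ) * t') * L + 2 / (√η * t') * (216 * L / ℓ) with hb
  have hb0 : 0 ≤ b := by positivity
  have hF : 𝔼 x, (𝔼 y, e (f x) x y + b * Real.log (Fintype.card X / #{x' | f x' = f x})) ≤
      unifError (Protocol.send msg next) + b * k := by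
    rw [expect_add_distrib, ← herr, ← mul_expect]
    gcongr
  obtain ⟨x₀, hx₀⟩ := exists_fiber_expect_le f _ hF
  set S : Finset X := {x | f x = f x₀} with hS
  have hSne : S.Nonempty := ⟨x₀, by simp [hS]⟩
  have hx₀' : 𝔼 x ∈ S, 𝔼 y, e (f x₀) x y + b * Real.log (Fintype.card X / #S) ≤
      unifError (Protocol.send msg next) + b * k := by
    refine le_trans (le_of_eq ?_) hx₀
    rw [expect_add_distrib]
    congr 1
    · exact expect_congr rfl fun x hx => by rw [(mem_filter.1 hx).2]
    · rw [← expect_const hSne (b * Real.log (Fintype.card X / #S))]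
      exact expect_congr rfl fun x hx => by rw [(mem_filter.1 hx).2]
  obtain ⟨U, V, hU, hUV⟩ := exists_embedding (J := Fin ℓ) (T := Fin t) (T' := Fin t') (m := m)
    (by simp only [Fintype.card_fin]; omega) (by simpa using h1R)
    (by simp only [Fintype.card_fin]; linarith) (by simpa using hℓt) hK (Real.sqrt_pos.2 hη0)
    (Real.sqrt_le_one.2 hη1) (e (f x₀)) (he0 _) (he1 _) S hSne
  -- The former receiver, who holds `v`, is now the player to move, so `V` comes first.
  refine ⟨Protocol.comap₂ (flatten ∘ V) (flatten ∘ U) (next (f x₀)), fun v u => ?_, ?_⟩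
  · rw [Protocol.messages_comap₂]
    have hmsg : msg (flatten (U u)) = f x₀ := (mem_filter.1 (hU u)).2
    have := hP (flatten (U u)) (flatten (V v))
    simp only [Protocol.messages, hmsg, List.length_cons, List.mem_cons] at this
    exact ⟨by simpa using this.1, fun w hw => this.2 w (Or.inr hw)⟩
  · have hle : unifError (Protocol.comap₂ (flatten ∘ V) (flatten ∘ U) (next (f x₀))) ≤
        𝔼 u, 𝔼 v, (e (f x₀) (U u) (V v) + mismatch (U u) (V v) u v) := by
      rw [unifError, expect_swap]
      refine expect_mono fun u => expect_mono fun v => ?_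
      rw [Protocol.run_comap₂]
      simp only [Function.comp_apply, he, mismatch, EE_flatten]
      by_cases hmm : (∃ i j, U u i j = V v i j) ↔ ∃ i, u i = v i
      · have : EE v u = decide (∃ i j, U u i j = V v i j) := by
          rw [EE_comm]
          simp only [EE, hmm]
        rw [if_pos hmm, this, add_zero]
      · rw [if_neg hmm]
        split_ifs <;> norm_num
    refine hle.trans (hUV.trans ?_)
    simp only [Fintype.card_fin]
    have hcost := embedding_cost_le (L := L) hmR hℓR (Nat.cast_nonneg k) h4R h1R h2R hη0 hη1 hKℓ (by
      rw [hL, inv_mul_le_iff₀ hlog]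
      linarith)
    have hsplit : ∀ D : ℝ,
        2 / ((ℓ : ℝ) * t') * (L * D + ℓ * L * m) +
          2 / (√η * t') * (216 * L / ℓ * D + (279 * (K / ℓ) + 216 * L) * m + √η ^ 2 * m) =
        b * D + (2 / ((ℓ : ℝ) * t') * (ℓ * L * m) +
          2 / (√η * t') * ((279 * (K / ℓ) + 216 * L) * m + √η ^ 2 * m)) := fun D => by
      rw [hb]; ring
    have e1 := hsplit k
    have e2 := hsplit (Real.log (Fintype.card X / #S))
    change _ + 2 / ((ℓ : ℝ) * t') * (L * Real.log (Fintype.card X / #S) + _) +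
      2 / (√η * t') * (216 * L / ℓ * Real.log (Fintype.card X / #S) + _ + _) ≤ _
    linarith

/-- Iterated round elimination. -/
theorem unifError_ge_of_isShort {m k : ℕ} (hm : 1 ≤ m) : ∀ (r : ℕ) (ℓ : ℕ → ℕ) (K η : ℕ → ℝ)
    (t n : ℕ), n = m * ∏ i ∈ range r, ℓ i →
    (∀ i < r, 2 ≤ ℓ i ∧ 0 < η i ∧ η i ≤ 1 ∧ 1 < K i ∧ K i / ℓ i ≤ η i ∧
      1 + k * (∏ j ∈ range i, (ℓ j : ℝ)) / (m * ∏ j ∈ range r, (ℓ j : ℝ)) ≤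
        η i * Real.log (K i)) →
    4 * n ≤ t → t + 2 * ∏ i ∈ range r, ℓ i ≤ 10 * n + 2 →
    ∀ P : Protocol (Vec t n), P.IsShort r k →
    1 / 11 ≤ unifError P + ∑ i ∈ range r, 249 * √(η i) +
      (1 - 1 / (∏ i ∈ range r, (ℓ i : ℝ))) / (4 * m) := by
  intro r
  induction r with
  | zero =>
    intro ℓ K η t n hn _ h4 h10 P hP
    simp only [range_zero, prod_empty, mul_one] at hn h10
    subst hn
    -- No message is sent, so the bound on lengths is vacuous.
    have : P.IsShort 0 1 := fun a b => by
      have := (hP a b).1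
      refine ⟨this, ?_⟩
      rw [List.length_eq_zero_iff.1 (Nat.le_zero.1 this)]
      simp
    have := unifError_ge_of_isShort_one hm h4 (by omega) this
    simpa using this
  | succ r ih =>
    intro ℓ K η t n hn hpar h4 h10 P hP
    have hmR : (1 : ℝ) ≤ m := by exact_mod_cast hm
    have hℓpos : ∀ i < r + 1, 0 < ℓ i := fun i hi => by have := (hpar i hi).1; omega
    have hQpos : 1 ≤ ∏ i ∈ range r, ℓ (i + 1) :=
      prod_pos fun i hi => hℓpos _ (by have := mem_range.1 hi; omega)
    have hQR : (1 : ℝ) ≤ ∏ i ∈ range r, (ℓ (i + 1) : ℝ) := by exact_mod_cast hQpos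
    have hsplitR : ∏ i ∈ range (r + 1), (ℓ i : ℝ) = (∏ i ∈ range r, (ℓ (i + 1) : ℝ)) * ℓ 0 :=
      prod_range_succ' _ _
    have hsplit : ∏ i ∈ range (r + 1), ℓ i = (∏ i ∈ range r, ℓ (i + 1)) * ℓ 0 :=
      prod_range_succ' _ _
    rw [hsplit] at hn h10
    set Q := ∏ i ∈ range r, ℓ (i + 1) with hQ
    have hQc : (Q : ℝ) = ∏ i ∈ range r, (ℓ (i + 1) : ℝ) := by rw [hQ]; push_cast; rfl
    obtain ⟨hℓ0, hη0, hη1, hK, hKℓ, hk⟩ := hpar 0 (by omega)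
    have hℓ0R : (2 : ℝ) ≤ ℓ 0 := by exact_mod_cast hℓ0
    rw [hsplitR, ← hQc]
    rw [← hQc] at hQR
    have hn' : n = m * Q * ℓ 0 := by rw [hn]; ring
    subst hn'
    have hsum0 : 0 ≤ ∑ i ∈ range (r + 1), 249 * √(η i) :=
      sum_nonneg fun i _ => by positivity
    have hmQ : 1 ≤ m * Q := Nat.mul_pos hm hQpos
    cases P with
    | output f =>
      have h1 : 1 / 11 ≤ unifError (Protocol.output f : Protocol (Vec t (m * Q * ℓ 0))) :=
        unifError_guess_ge (Nat.mul_pos hmQ (by omega)) h4 (by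
          have : 1 ≤ Q * ℓ 0 := Nat.mul_pos hQpos (by omega)
          omega) f
      have h2 : 0 ≤ (1 - 1 / ((Q : ℝ) * ℓ 0)) / (4 * m) := by
        refine div_nonneg (sub_nonneg.2 ?_) (by linarith)
        rw [div_le_one (by positivity)]
        nlinarith
      linarith
    | send msg next =>
      -- Rounding up, so that `t ≤ ℓ 0 * t'`.
      set t' := (t + (ℓ 0 - 1)) / ℓ 0 with ht'
      have hdm := Nat.div_add_mod (t + (ℓ 0 - 1)) (ℓ 0)
      have hmod := Nat.mod_lt (t + (ℓ 0 - 1)) (show 0 < ℓ 0 by omega)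
      rw [← ht'] at hdm
      obtain ⟨P', hP', herr⟩ := exists_round_elimination (t' := t') (m := m * Q) (ℓ := ℓ 0)
        (K := K 0) (η := η 0) hmQ (by omega) h4 (by omega) (by omega) hη0 hη1 hK hKℓ (by
          refine le_trans (le_of_eq ?_) hk
          rw [hsplitR, ← hQc]
          push_cast
          simp [mul_assoc]) msg next hP
      have hlow : 4 * (m * Q) ≤ t' := by
        have h5 : ℓ 0 * (4 * (m * Q)) ≤ ℓ 0 * t' := by
          have : ℓ 0 * (4 * (m * Q)) = 4 * (m * Q * ℓ 0) := by ring
          omega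
        exact Nat.le_of_mul_le_mul_left h5 (by omega)
      -- The slack `2 * Q` against `2` absorbs the repeated rounding of alphabet sizes, as `2 + ℓ 0
      -- ≤ 2 * ℓ 0`.
      have hupp : t' + 2 * Q ≤ 10 * (m * Q) + 2 := by
        have h5 : ℓ 0 * (t' + 2 * Q) ≤ ℓ 0 * (10 * (m * Q) + 2) := by
          have e1 : ℓ 0 * (t' + 2 * Q) = ℓ 0 * t' + 2 * (Q * ℓ 0) := by ring
          have e2 : ℓ 0 * (10 * (m * Q) + 2) = 10 * (m * Q * ℓ 0) + 2 * ℓ 0 := by ring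
          omega
        exact Nat.le_of_mul_le_mul_left h5 (by omega)
      have := ih (fun i => ℓ (i + 1)) (fun i => K (i + 1)) (fun i => η (i + 1)) t' (m * Q) rfl
        (fun i hi => by
          obtain ⟨a1, a2, a3, a4, a5, a6⟩ := hpar (i + 1) (by omega)
          refine ⟨a1, a2, a3, a4, a5, le_trans (le_of_eq ?_) a6⟩
          rw [hsplitR, prod_range_succ']
          have : (∏ j ∈ range r, (ℓ (j + 1) : ℝ)) ≠ 0 := by rw [← hQc]; positivity
          field_simp)
        hlow hupp P' hP'
      rw [← hQc] at this
      -- The losses `1 / (8 m Q)` are dominated by a telescoping sum because `ℓ 0 ≥ 2`.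
      have hcost : 1 / (8 * ((m : ℝ) * Q)) + (1 - 1 / (Q : ℝ)) / (4 * m) ≤
          (1 - 1 / ((Q : ℝ) * ℓ 0)) / (4 * m) := by
        have e : (1 - 1 / ((Q : ℝ) * ℓ 0)) / (4 * m) -
            (1 / (8 * ((m : ℝ) * Q)) + (1 - 1 / (Q : ℝ)) / (4 * m)) =
            (ℓ 0 - 2) / (8 * m * Q * ℓ 0) := by
          field_simp
          ring
        have : 0 ≤ ((ℓ 0 : ℝ) - 2) / (8 * m * Q * ℓ 0) := div_nonneg (by linarith) (by positivity)
        linarith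
      rw [sum_range_succ']
      push_cast at herr
      linarith

end RoundElimination

/-! ### Discarding surplus coordinates -/

section FixCoordinates

theorem expect_append {t n d : ℕ} (F : Vec t (n + d) → ℝ) :
    𝔼 a, F a = 𝔼 z : Vec t d, 𝔼 x : Vec t n, F (Fin.append x z) := by
  rw [expect_swap, ← expect_prod_type fun p : Vec t n × Vec t d => F (Fin.append p.1 p.2)]
  exact (Fintype.expect_equiv (Fin.appendEquiv n d) _ _ fun _ => rfl).symm

/-- Fixing some coordinates of both inputs. -/
theorem exists_restrict {t n n₀ d r k : ℕ} (hn : n = n₀ + d) (ht : 1 ≤ t) (hd : 4 * d ≤ t)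
    (P : Protocol (Vec t n)) (hP : P.IsShort r k) :
    ∃ P' : Protocol (Vec t n₀), P'.IsShort r k ∧ unifError P' ≤ 4 / 3 * unifError P := by
  subst hn
  have : Nonempty (Fin t) := ⟨⟨0, ht⟩⟩
  have htR : (1 : ℝ) ≤ t := by exact_mod_cast ht
  have hdR : 4 * (d : ℝ) ≤ t := by exact_mod_cast hd
  set G : Vec t d × Vec t d → ℝ := fun p => 𝔼 x : Vec t n₀, 𝔼 y : Vec t n₀,
    if P.run (Fin.append x p.1) (Fin.append y p.2) = EE (Fin.append x p.1) (Fin.append y p.2)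
      then 0 else 1 with hG
  have hG0 : ∀ p, 0 ≤ G p := fun p => expect_nonneg' fun x => expect_nonneg' fun y => by
    split_ifs <;> norm_num
  have herr : unifError P = 𝔼 p, G p := by
    calc unifError P = 𝔼 z : Vec t d, 𝔼 x : Vec t n₀, 𝔼 w : Vec t d, 𝔼 y : Vec t n₀,
          (if P.run (Fin.append x z) (Fin.append y w) = EE (Fin.append x z) (Fin.append y w)
            then (0 : ℝ) else 1) := by
          refine (expect_append _).trans ?_
          exact expect_congr rfl fun z _ => expect_congr rfl fun x _ => expect_append _
      _ = 𝔼 z : Vec t d, 𝔼 w : Vec t d, G (z, w) :=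
          expect_congr rfl fun z _ => expect_swap _
      _ = 𝔼 p, G p := (expect_prod_type G).symm
  set I : Vec t d × Vec t d → ℝ := fun p => if EE p.1 p.2 = true then 0 else 1 with hI
  set q : ℝ := (1 - 1 / (t : ℝ)) ^ d with hq
  have hI1 : 𝔼 p, I p = q := by
    rw [expect_prod_type]
    simp only [hI, expect_EE_false ht, Fintype.expect_const, hq]
  have hq34 : 3 / 4 ≤ q := by
    have ht1 : 1 / (t : ℝ) ≤ 1 := by rw [div_le_one (by linarith)]; linarith
    have := one_add_mul_le_pow (a := -(1 / (t : ℝ))) (by linarith) d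
    rw [← sub_eq_add_neg] at this
    refine le_trans ?_ this
    have : (d : ℝ) * (1 / t) ≤ 1 / 4 := by
      rw [mul_one_div, div_le_iff₀ (by linarith)]
      linarith
    linarith
  have hI0 : ∀ p, 0 ≤ I p := fun p => by simp only [hI]; split_ifs <;> norm_num
  have hI' : ∀ p, I p ≤ 1 := fun p => by simp only [hI]; split_ifs <;> norm_num
  set c := 4 / 3 * unifError P with hc
  -- Fixed parts that agree have weight zero; the artificial value `c + 1` excludes them from the
  -- choice of a pair with value at most `c`.
  have hle : 𝔼 p, q⁻¹ * I p * (if EE p.1 p.2 = true then c + 1 else G p) ≤ c := by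
    have h1 : ∀ p, q⁻¹ * I p * (if EE p.1 p.2 = true then c + 1 else G p) ≤ 4 / 3 * G p := by
      intro p
      have h2 : q⁻¹ ≤ 4 / 3 := by
        rw [inv_le_comm₀ (by linarith) (by norm_num)]
        norm_num
        linarith
      simp only [hI]
      split_ifs
      · have := hG0 p
        simp only [mul_zero, zero_mul]
        positivity
      · rw [mul_one]
        exact mul_le_mul_of_nonneg_right h2 (hG0 p)
    refine (expect_mono h1).trans_eq ?_
    rw [← mul_expect, hc, herr]
  obtain ⟨⟨z, w⟩, hzw⟩ := exists_le_of_expect_mul_le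
    (fun p => mul_nonneg (inv_nonneg.2 (by linarith : 0 ≤ q)) (hI0 p))
    (by rw [← mul_expect, hI1]; exact inv_mul_cancel₀ (by linarith)) hle
  by_cases hEE : EE z w = true
  · simp only [hEE, if_true] at hzw
    linarith
  rw [if_neg hEE] at hzw
  refine ⟨Protocol.comap₂ (fun x => Fin.append x z) (fun y => Fin.append y w) P, ?_, ?_⟩
  · intro a b
    rw [Protocol.messages_comap₂]
    exact hP _ _
  · refine le_trans (le_of_eq ?_) hzw
    refine expect_congr rfl fun x _ => expect_congr rfl fun y _ => ?_
    rw [Protocol.run_comap₂]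
    have : EE (Fin.append x z) (Fin.append y w) = EE x y := by
      simp only [EE, decide_eq_decide]
      constructor
      · rintro ⟨i, hi⟩
        refine Fin.addCases (fun i hi => ?_) (fun i hi => ?_) i hi
        · exact ⟨i, by simpa using hi⟩
        · exact absurd (by simpa [EE] using ⟨i, by simpa using hi⟩) hEE
      · rintro ⟨i, hi⟩
        exact ⟨Fin.castAdd d i, by simpa using hi⟩
    rw [this]

end FixCoordinates

/-! ### From measure to averages -/

section Error

theorem distError_eq_unifError {n : ℕ} (P : Protocol (Vec (4 * n) n)) (first : Player) :
    distError P first = unifError P := by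
  have h1 : distError P first = 𝔼 p : Vec (4 * n) n × Vec (4 * n) n,
      if P.eval first p.1 p.2 = EE p.1 p.2 then 0 else 1 := by
    classical
    rw [distError, nu, MeasureTheory.measureReal_def, ProbabilityTheory.uniformOn_univ,
      Fintype.expect_eq_sum_div_card, ENNReal.toReal_div]
    congr 1
    have : {p : Vec (4 * n) n × Vec (4 * n) n | P.eval first p.1 p.2 ≠ EE p.1 p.2} =
        ((univ.filter fun p : Vec (4 * n) n × Vec (4 * n) n =>
          P.eval first p.1 p.2 ≠ EE p.1 p.2 : Finset _) : Set _) := by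
      ext; simp
    rw [this, MeasureTheory.Measure.count_apply_finset]
    simp only [ENNReal.toReal_natCast]
    rw [← sum_boole]
    refine sum_congr rfl fun p _ => ?_
    split_ifs <;> simp_all
  rw [h1, expect_prod_type]
  cases first with
  | alice => rfl
  | bob =>
    rw [expect_swap]
    refine expect_congr rfl fun a _ => expect_congr rfl fun b _ => ?_
    rw [Protocol.eval, EE_comm b a]

end Error

/-! ### Growth of towers -/

section Growth

theorem one_add_half_le_two_rpow {x : ℝ} (hx : 0 ≤ x) : 1 + x / 2 ≤ (2 : ℝ) ^ x := by
  rw [Real.rpow_def_of_pos (by norm_num)]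
  have h1 := Real.add_one_le_exp (Real.log 2 * x)
  have h2 : x / 2 ≤ Real.log 2 * x := by nlinarith [Real.log_two_gt_d9]
  linarith

theorem exp_le_two_rpow {x : ℝ} (hx : 0 ≤ x) : Real.exp (5 / 8 * x) ≤ (2 : ℝ) ^ x := by
  rw [Real.rpow_def_of_pos (by norm_num)]
  apply Real.exp_le_exp.2
  nlinarith [Real.log_two_gt_d9]

/-- The tower is at least `1, 2, 4, 16`, and `2 ^ x ≥ 16 x` for `x ≥ 16`. Consequently `4 ^ k` is
`O(√(T k))`, which pays for `η i` shrinking like `4^(-i)`. -/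
theorem tower_ge {T : ℕ → ℝ} {r : ℕ} (h0 : 1 ≤ T 0) (hT : ∀ k < r, T (k + 1) = 2 ^ T k) :
    ∀ k ≤ r, 1 ≤ T k ∧ (16 : ℝ) ^ k / 256 ≤ T k := by
  have hmono : ∀ k < r, ∀ x, x ≤ T k → (2 : ℝ) ^ x ≤ T (k + 1) := fun k hk x hx => by
    rw [hT k hk]
    exact Real.rpow_le_rpow_of_exponent_le (by norm_num) hx
  have key : ∀ k ≤ r, (k = 0 → 1 ≤ T k) ∧ (k = 1 → 2 ≤ T k) ∧ (k = 2 → 4 ≤ T k) ∧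
      (3 ≤ k → 16 ≤ T k ∧ (16 : ℝ) ^ k / 256 ≤ T k) := by
    intro k
    induction k with
    | zero => exact fun _ => ⟨fun _ => h0, by omega, by omega, by omega⟩
    | succ k ih =>
      intro hk
      obtain ⟨a0, a1, a2, a3⟩ := ih (by omega)
      refine ⟨by omega, fun h => ?_, fun h => ?_, fun h => ?_⟩
      · have := hmono k (by omega) 1 (a0 (by omega))
        norm_num at this
        exact this
      · have := hmono k (by omega) 2 (a1 (by omega))
        norm_num at this
        exact this
      · rcases Nat.lt_or_ge k 3 with h3 | h3
        · have hk2 : k = 2 := by omega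
          have := hmono k (by omega) 4 (a2 hk2)
          subst hk2
          norm_num at this ⊢
          exact this
        · obtain ⟨b1, b2⟩ := a3 h3
          have h5 : 16 * T k ≤ T (k + 1) := by
            rw [hT k (by omega)]
            have e1 := one_add_half_le_two_rpow (x := T k - 16) (by linarith)
            have e2 : (2 : ℝ) ^ T k = 2 ^ (T k - 16) * 65536 := by
              rw [Real.rpow_sub (by norm_num)]
              norm_num
            rw [e2]
            linarith
          refine ⟨by linarith, ?_⟩
          rw [pow_succ]
          linarith
  intro k hk
  obtain ⟨a0, a1, a2, a3⟩ := key k hk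
  rcases Nat.lt_or_ge k 3 with h3 | h3
  · interval_cases k
    · have := a0 rfl
      exact ⟨by linarith, by norm_num; linarith⟩
    · have := a1 rfl
      exact ⟨by linarith, by norm_num; linarith⟩
    · have := a2 rfl
      exact ⟨by linarith, by norm_num; linarith⟩
  · obtain ⟨b1, b2⟩ := a3 h3
    exact ⟨by linarith, b2⟩

theorem pow_three_mul_exp_le {x : ℝ} (hx : 0 ≤ x) :
    x ^ 3 * Real.exp (x / 8) ≤ 48 * (2 : ℝ) ^ x := by
  have h1 : (x / 2) ^ 3 / 6 ≤ Real.exp (x / 2) := by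
    have := Real.pow_div_factorial_le_exp (x / 2) (by linarith) 3
    simpa [Nat.factorial] using this
  have h2 : x ^ 3 ≤ 48 * Real.exp (x / 2) := by nlinarith
  calc x ^ 3 * Real.exp (x / 8) ≤ 48 * Real.exp (x / 2) * Real.exp (x / 8) := by gcongr
    _ = 48 * Real.exp (5 / 8 * x) := by
      rw [mul_assoc, ← Real.exp_add]
      ring_nf
    _ ≤ _ := by gcongr; exact exp_le_two_rpow hx

theorem sq_mul_exp_mul_le {x : ℝ} (hx : 0 ≤ x) :
    x ^ 2 * Real.exp (x / 8) * (x / 4) ≤ 32 * (2 : ℝ) ^ x := by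
  have := pow_three_mul_exp_le hx
  have e : x ^ 2 * Real.exp (x / 8) * (x / 4) = x ^ 3 * Real.exp (x / 8) / 4 := by ring
  rw [e]
  have : 0 < (2 : ℝ) ^ x := by positivity
  linarith

end Growth

/-! ### Choice of block lengths -/

section Parameters

/-- The block lengths and thresholds for iterated round elimination along a tower of
exponentials. -/
theorem exists_parameters {η₀ : ℝ} (h0 : 0 < η₀) (h1 : η₀ ≤ 1) :
    ∃ γ : ℝ, 0 < γ ∧ ∃ N₀ : ℝ, ∀ (T : ℕ → ℝ) (r : ℕ), 1 ≤ T 0 →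
      (∀ k < r, T (k + 1) = 2 ^ T k) → N₀ ≤ T r →
      ∃ (ℓ : ℕ → ℕ) (K : ℕ → ℝ),
        (∀ i < r, 2 ≤ ℓ i ∧ 1 < K i ∧ K i / ℓ i ≤ η₀ / 4 ^ i ∧
          1 + 4 * γ * T 0 * ∏ j ∈ range i, (ℓ j : ℝ) ≤ η₀ / 4 ^ i * Real.log (K i)) ∧
        101 * ∏ j ∈ range r, (ℓ j : ℝ) ≤ T r := by
  -- With `T i ≥ 16 ^ i / 256`, the arithmetic–geometric mean inequality yields `2 * 4 ^ i / η₀ ≤ A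
  -- + T i / 8`, which absorbs the summand `1`.
  set A : ℝ := 2048 * (1 / η₀) ^ 2 with hA
  set C : ℝ := 32 / η₀ * Real.exp A with hC
  have hC0 : 0 < C := by positivity
  set D : ℝ := Real.exp (512 * (192 * C)) with hD
  have hD0 : 0 < D := Real.exp_pos _
  -- `12928 = 4 * 32 * 101` lets the last tower step absorb the factor `101 * D * C`; the summand
  -- `200` handles `r = 0`.
  refine ⟨η₀ / (64 * D), by positivity, 2 ^ (12928 * (D * C) + 200), ?_⟩
  intro T r hT0 hT hN
  have hT1 := tower_ge hT0 hT
  set K : ℕ → ℝ := fun i => Real.exp (A + T i / 8) with hK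
  set ℓ : ℕ → ℕ := fun i => ⌈K i / (η₀ / 4 ^ i)⌉₊ with hℓ
  have hA0 : 0 < A := by positivity
  have hK1 : ∀ i ≤ r, 1 < K i := fun i hi => by
    have := (hT1 i hi).1
    exact Real.one_lt_exp_iff.2 (by linarith)
  have hKη : ∀ i ≤ r, 1 < K i / (η₀ / 4 ^ i) := fun i hi => by
    have h4 : (1 : ℝ) ≤ 4 ^ i := one_le_pow₀ (by norm_num)
    rw [lt_div_iff₀ (by positivity), one_mul]
    refine lt_of_le_of_lt ?_ (hK1 i hi)
    rw [div_le_one (by positivity)]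
    linarith
  have hℓle : ∀ i ≤ r, (ℓ i : ℝ) ≤ C * T i * Real.exp (T i / 8) := by
    intro i hi
    obtain ⟨hTi, hTi'⟩ := hT1 i hi
    have h2 : (ℓ i : ℝ) ≤ 2 * (K i / (η₀ / 4 ^ i)) := by
      have := (Nat.ceil_lt_add_one (zero_le_one.trans (hKη i hi).le)).le
      simp only [hℓ]
      linarith [hKη i hi]
    have h4 : (4 : ℝ) ^ i ≤ 16 * T i := by
      have h16 : ((4 : ℝ) ^ i) ^ 2 = 16 ^ i := by rw [← pow_mul, mul_comm, pow_mul]; norm_num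
      have : ((4 : ℝ) ^ i) ^ 2 ≤ (16 * T i) ^ 2 := by rw [h16]; nlinarith
      exact (abs_le_of_sq_le_sq' this (by linarith)).2
    calc (ℓ i : ℝ) ≤ 2 * (K i / (η₀ / 4 ^ i)) := h2
      _ = 2 / η₀ * Real.exp A * Real.exp (T i / 8) * 4 ^ i := by
        simp only [hK, Real.exp_add]
        field_simp
      _ ≤ 2 / η₀ * Real.exp A * Real.exp (T i / 8) * (16 * T i) := by gcongr
      _ = _ := by rw [hC]; ring
  have hclaim : ∀ k ≤ r, T 0 * ∏ j ∈ range k, (ℓ j : ℝ) ≤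
      Real.exp (512 * (192 * C) * (1 - (1 / 2) ^ k)) * (T k / 4 ^ k) := by
    intro k
    induction k with
    | zero => intro _; simp
    | succ k ih =>
      intro hk
      have hk' : k ≤ r := by omega
      obtain ⟨hTk, hTk'⟩ := hT1 k hk'
      have hTk0 : 0 < T k := by linarith
      set E := Real.exp (512 * (192 * C) * (1 - (1 / 2) ^ k)) with hE
      have hE0 : 0 < E := Real.exp_pos _
      have hEs : Real.exp (512 * (192 * C) * (1 - (1 / 2) ^ (k + 1))) =
          E * Real.exp (256 * (192 * C) * (1 / 2) ^ k) := by
        rw [hE, ← Real.exp_add]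
        congr 1
        ring
      -- Each step multiplies the constant by at most `192 * C / T k`. As `T k ≥ 2 ^ k / 256`, the
      -- resulting exponents form a geometric series, so the product never exceeds `D`.
      have hfac : 192 * C / T k ≤ Real.exp (256 * (192 * C) * (1 / 2) ^ k) := by
        have h5 := Real.add_one_le_exp (256 * (192 * C) * (1 / 2) ^ k)
        refine le_trans ?_ (le_trans (le_add_of_nonneg_right zero_le_one) h5)
        have h6 : (2 : ℝ) ^ k / 256 ≤ T k := by
          refine le_trans ?_ hTk'
          gcongr
          norm_num
        have h7 : (256 : ℝ) * (192 * C) * (1 / 2) ^ k = 192 * C / (2 ^ k / 256) := by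
          rw [div_pow, one_pow]
          field_simp
        rw [h7]
        gcongr
      rw [prod_range_succ, ← mul_assoc, hEs, hT k (by omega)]
      have h8 := pow_three_mul_exp_le hTk0.le
      calc (T 0 * ∏ j ∈ range k, (ℓ j : ℝ)) * ℓ k
          ≤ E * (T k / 4 ^ k) * (C * T k * Real.exp (T k / 8)) :=
            mul_le_mul (ih hk') (hℓle k hk') (Nat.cast_nonneg _) (by positivity)
        _ = E * (4 * C / T k) * (T k ^ 3 * Real.exp (T k / 8)) / 4 ^ (k + 1) := by
            field_simp
            ring
        _ ≤ E * (4 * C / T k) * (48 * 2 ^ T k) / 4 ^ (k + 1) := by gcongr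
        _ = E * (192 * C / T k) * (2 ^ T k / 4 ^ (k + 1)) := by ring
        _ ≤ _ := by gcongr
  have hclaimD : ∀ k ≤ r, T 0 * ∏ j ∈ range k, (ℓ j : ℝ) ≤ D * (T k / 4 ^ k) := by
    intro k hk
    have hTk := (hT1 k hk).1
    refine (hclaim k hk).trans ?_
    gcongr
    rw [hD]
    apply Real.exp_le_exp.2
    have : (0 : ℝ) ≤ (1 / 2) ^ k := by positivity
    have hc : 0 ≤ 512 * (192 * C) := by positivity
    nlinarith
  refine ⟨ℓ, K, fun i hi => ⟨?_, hK1 i hi.le, ?_, ?_⟩, ?_⟩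
  · have := Nat.lt_ceil.2 (show ((1 : ℕ) : ℝ) < K i / (η₀ / 4 ^ i) by
      exact_mod_cast hKη i hi.le)
    exact this
  · have hpos : (0 : ℝ) < ℓ i := lt_of_lt_of_le (zero_lt_one.trans (hKη i hi.le)) (Nat.le_ceil _)
    rw [div_le_iff₀ hpos]
    have := Nat.le_ceil (K i / (η₀ / 4 ^ i))
    rw [div_le_iff₀ (by positivity), mul_comm] at this
    exact this
  · obtain ⟨hTi, hTi'⟩ := hT1 i hi.le
    have hlogK : Real.log (K i) = A + T i / 8 := by simp only [hK, Real.log_exp]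
    rw [hlogK]
    set x : ℝ := 4 ^ i with hx
    have hx1 : 1 ≤ x := one_le_pow₀ (by norm_num)
    have h16 : x ^ 2 = 16 ^ i := by rw [hx, ← pow_mul, mul_comm, pow_mul]; norm_num
    rw [← h16] at hTi'
    have hone : 1 ≤ 1 / 2 * (η₀ / x * (A + T i / 8)) := by
      have h9 : 2 * (1 / η₀) * x ≤ A + T i / 8 := by
        rw [hA]
        nlinarith [sq_nonneg (2048 * (1 / η₀) - x)]
      calc (1 : ℝ) = 1 / 2 * (η₀ / x * (2 * (1 / η₀) * x)) := by field_simp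
        _ ≤ _ := by gcongr
    have htwo : 4 * (η₀ / (64 * D)) * T 0 * ∏ j ∈ range i, (ℓ j : ℝ) ≤
        1 / 2 * (η₀ / x * (A + T i / 8)) := by
      calc 4 * (η₀ / (64 * D)) * T 0 * ∏ j ∈ range i, (ℓ j : ℝ)
          = 4 * (η₀ / (64 * D)) * (T 0 * ∏ j ∈ range i, (ℓ j : ℝ)) := by ring
        _ ≤ 4 * (η₀ / (64 * D)) * (D * (T i / x)) :=
            mul_le_mul_of_nonneg_left (hclaimD i hi.le) (by positivity)
        _ = 1 / 2 * (η₀ / x * (T i / 8)) := by field_simp; norm_num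
        _ ≤ _ := by gcongr; linarith
    linarith
  · rcases r with _ | j
    · have := one_add_half_le_two_rpow (x := 12928 * (D * C) + 200) (by positivity)
      have hDC : 0 < D * C := by positivity
      simp only [range_zero, prod_empty, mul_one]
      linarith
    · obtain ⟨hTj, hTj'⟩ := hT1 j (by omega)
      have hTr := hT j (by omega)
      have hbig : 12928 * (D * C) ≤ T j := by
        rw [hTr] at hN
        have := (Real.rpow_le_rpow_left_iff (by norm_num : (1 : ℝ) < 2)).1 hN
        linarith
      have hPj : ∏ i ∈ range j, (ℓ i : ℝ) ≤ D * T j := by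
        have h5 := hclaimD j (by omega)
        have hnn : 0 ≤ ∏ i ∈ range j, (ℓ i : ℝ) := prod_nonneg fun i _ => Nat.cast_nonneg _
        have h6 : T j / 4 ^ j ≤ T j := div_le_self (by linarith) (one_le_pow₀ (by norm_num))
        have h7 : D * (T j / 4 ^ j) ≤ D * T j := by gcongr
        nlinarith
      rw [prod_range_succ]
      have h8 : (∏ i ∈ range j, (ℓ i : ℝ)) * ℓ j ≤ D * T j * (C * T j * Real.exp (T j / 8)) :=
        mul_le_mul hPj (hℓle j (by omega)) (Nat.cast_nonneg _) (by positivity)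
      have h9 := sq_mul_exp_mul_le (x := T j) (by linarith)
      rw [← hTr] at h9
      have h10 : 0 < 3232 * (D * C) := by positivity
      have h11 : 3232 * (D * C) ≤ T j / 4 := by linarith
      have h12 : T j ^ 2 * Real.exp (T j / 8) * (3232 * (D * C)) ≤ 32 * T (j + 1) :=
        le_trans (by gcongr) h9
      have h13 : 101 * (D * T j * (C * T j * Real.exp (T j / 8))) =
          T j ^ 2 * Real.exp (T j / 8) * (3232 * (D * C)) / 32 := by ring
      linarith

end Parameters

/-! ### Assembling the lower bound -/

section Main

theorem two_le_logIter {x : ℝ} {i : ℕ} (h : i < logStar x) : 2 ≤ logIter i x := by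
  have := Nat.notMem_of_lt_sInf h
  simpa using this

/-- Read backwards, iterated logarithms form a tower; `r ≤ log* n` keeps every argument of a
logarithm at least `2`. -/
theorem logIter_tower {n r : ℕ} (hn : 1 ≤ n) (hr : r ≤ logStar (n : ℝ)) :
    1 ≤ logIter (r - 0) (n : ℝ) ∧
      ∀ k < r, logIter (r - (k + 1)) (n : ℝ) = 2 ^ logIter (r - k) (n : ℝ) := by
  constructor
  · rcases r with _ | r
    · simpa [logIter] using hn
    · change 1 ≤ Real.logb 2 (logIter r n)
      have := two_le_logIter (x := n) (i := r) (by omega)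
      rw [Real.le_logb_iff_rpow_le (by norm_num) (by linarith)]
      simpa using this
  · intro k hk
    obtain ⟨i, hi⟩ : ∃ i, r - k = i + 1 := ⟨r - (k + 1), by omega⟩
    have hi' : r - (k + 1) = i := by omega
    have := two_le_logIter (x := n) (i := i) (by omega)
    rw [hi, hi']
    change _ = (2 : ℝ) ^ Real.logb 2 (logIter i n)
    rw [Real.rpow_logb (by norm_num) (by norm_num) (by linarith)]

theorem tower_mono {T : ℕ → ℝ} {r : ℕ} (h0 : 1 ≤ T 0) (hT : ∀ k < r, T (k + 1) = 2 ^ T k) :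
    ∀ k ≤ r, T 0 ≤ T k := by
  intro k
  induction k with
  | zero => exact fun _ => le_rfl
  | succ k ih =>
    intro hk
    refine (ih (by omega)).trans ?_
    have h1 := (tower_ge h0 hT k (by omega)).1
    rw [hT k (by omega)]
    have := one_add_half_le_two_rpow (x := T k - 1) (by linarith)
    have e : (2 : ℝ) ^ T k = 2 ^ (T k - 1) * 2 := by
      rw [Real.rpow_sub (by norm_num), Real.rpow_one]
      ring
    rw [e]
    linarith

theorem exists_unifError_gt : ∃ γ : ℝ, 0 < γ ∧ ∃ N₀ : ℝ, ∀ n : ℕ, 1 ≤ n → N₀ ≤ n → ∀ r k : ℕ,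
    r ≤ logStar (n : ℝ) → (k : ℝ) ≤ 2 * γ * (n * logIter r n) →
    ∀ P : Protocol (Vec (4 * n) n), P.IsShort r k → 1 / 20 < unifError P := by
  obtain ⟨γ, hγ, N₀, hpar⟩ := exists_parameters (η₀ := (1 / 100000) ^ 2) (by norm_num)
    (by norm_num)
  refine ⟨γ, hγ, N₀, fun n hn hN r k hr hk P hP => ?_⟩
  obtain ⟨hT0, hT⟩ := logIter_tower hn hr
  obtain ⟨ℓ, K, hℓ, hQ⟩ := hpar (fun i => logIter (r - i) n) r hT0 hT (by simpa [logIter] using hN)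
  simp only [Nat.sub_self, logIter, Nat.sub_zero] at hQ hℓ hT0
  have hnR : (1 : ℝ) ≤ n := by exact_mod_cast hn
  set Q := ∏ i ∈ range r, ℓ i with hQdef
  have hQc : ∏ i ∈ range r, (ℓ i : ℝ) = Q := by rw [hQdef]; push_cast; rfl
  rw [hQc] at hQ
  have hQpos : 0 < Q := Finset.prod_pos fun i hi => by
    have := (hℓ i (mem_range.1 hi)).1
    omega
  have hQn : 101 * Q ≤ n := by exact_mod_cast hQ
  -- Since `101 * Q ≤ n`, the final instance has `m ≥ 100` coordinates, and the `n % Q` surplus ones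
  -- are few enough to be fixed.
  set m := n / Q with hm
  have hm100 : 100 ≤ m := by
    rw [hm, Nat.le_div_iff_mul_le hQpos]
    omega
  have hmod := Nat.div_add_mod n Q
  have hlt := Nat.mod_lt n hQpos
  have hnm : n = m * Q + n % Q := by rw [hm, mul_comm]; exact hmod.symm
  have hmQ : n ≤ 2 * (m * Q) := by
    have : 100 * Q ≤ m * Q := Nat.mul_le_mul_right _ hm100
    omega
  obtain ⟨P', hP', herr⟩ := exists_restrict hnm (t := 4 * n) (by omega) (by omega) P hP
  have hQR : (1 : ℝ) ≤ Q := by exact_mod_cast hQpos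
  have hmR : (100 : ℝ) ≤ m := by exact_mod_cast hm100
  have hmQR : (n : ℝ) ≤ 2 * (m * Q) := by exact_mod_cast hmQ
  have hmQle : m * Q ≤ n := by omega
  have hmain := unifError_ge_of_isShort (m := m) (k := k) (by omega) r ℓ K
    (fun i => (1 / 100000) ^ 2 / 4 ^ i) (4 * n) (m * Q) rfl (fun i hi => by
      obtain ⟨a1, a2, a3, a4⟩ := hℓ i hi
      refine ⟨a1, by positivity, ?_, a2, a3, le_trans ?_ a4⟩
      · rw [div_le_one (by positivity)]
        refine le_trans ?_ (one_le_pow₀ (by norm_num))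
        norm_num
      · have hnn : 0 ≤ ∏ j ∈ range i, (ℓ j : ℝ) := prod_nonneg fun j _ => Nat.cast_nonneg _
        rw [hQc]
        gcongr
        rw [div_le_iff₀ (by positivity)]
        have h5 : (k : ℝ) ≤ 4 * γ * logIter r n * (m * Q) := by
          refine hk.trans ?_
          have : 2 * γ * (n * logIter r n) = 2 * γ * logIter r n * n := by ring
          rw [this]
          have h6 : 0 ≤ 2 * γ * logIter r n := by positivity
          nlinarith
        nlinarith [mul_le_mul_of_nonneg_right h5 hnn])
    (by omega) (by
      have : 100 * Q ≤ m * Q := Nat.mul_le_mul_right _ hm100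
      omega) P' hP'
  have hsum : ∑ i ∈ range r, 249 * √((1 / 100000) ^ 2 / 4 ^ i : ℝ) ≤ 249 * (2 * (1 / 100000)) := by
    have h6 : ∀ i ∈ range r, 249 * √((1 / 100000) ^ 2 / 4 ^ i : ℝ) =
        249 * (1 / 100000) * (1 / 2) ^ i := fun i _ => by
      have : ((1 / 100000) ^ 2 / 4 ^ i : ℝ) = (1 / 100000 * (1 / 2) ^ i) ^ 2 := by
        rw [mul_pow, ← pow_mul, mul_comm i 2, pow_mul, div_eq_mul_inv, ← inv_pow]
        norm_num
      rw [this, Real.sqrt_sq (by positivity)]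
      ring
    rw [sum_congr rfl h6, ← mul_sum]
    have h7 : ∑ i ∈ range r, (1 / 2 : ℝ) ^ i ≤ 2 := by
      have := sum_geometric_two_le r
      simpa using this
    linarith
  rw [hQc] at hmain
  have hlast : (1 - 1 / (Q : ℝ)) / (4 * m) ≤ 1 / 400 := by
    have h8 : 0 ≤ 1 / (Q : ℝ) := by positivity
    rw [div_le_div_iff₀ (by linarith) (by norm_num)]
    linarith
  linarith

end Main

end ExistsEqual

theorem mainTheorem2 :
    ∃ ε₀ : ℝ, 0 < ε₀ ∧ ∃ γ : ℝ, 0 < γ ∧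
      ∀ n : ℕ, 1 ≤ n → ∀ r : ℕ, r ≤ ExistsEqual.logStar (n : ℝ) →
        ∀ (first : ExistsEqual.Player)
          (P : ExistsEqual.Protocol (ExistsEqual.Vec (4 * n) n)),
          P.IsRound first r →
          ExistsEqual.distError P first ≤ ε₀ →
          P.SendsMessageOfSize first (γ * (n * ExistsEqual.logIter r (n : ℝ))) := by
  obtain ⟨γ, hγ, N₀, hmain⟩ := ExistsEqual.exists_unifError_gt
  obtain ⟨N, hN⟩ := exists_nat_gt (max 1 (max N₀ (1 / γ)))
  have hN1 : (1 : ℝ) < N := (le_max_left _ _).trans_lt hN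
  have hNN : N₀ ≤ N := ((le_max_left _ _).trans (le_max_right _ _)).trans hN.le
  have hNγ : 1 / γ ≤ N := ((le_max_right _ _).trans (le_max_right _ _)).trans hN.le
  -- The bound `1 / N ^ 2` settles `n < N`: as `log^(r) n ≤ n`, the claimed size is at most `1`, so
  -- a counterexample sends only empty messages. For `n ≥ N`, rounding up is absorbed by the factor
  -- `2` in `exists_unifError_gt`.
  refine ⟨1 / 20, by norm_num, min γ (1 / (N : ℝ) ^ 2), lt_min hγ (by positivity), ?_⟩
  intro n hn r hr first P hround herr
  rw [ExistsEqual.distError_eq_unifError] at herr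
  obtain ⟨hT0, hT⟩ := ExistsEqual.logIter_tower hn hr
  have hTn := ExistsEqual.tower_mono (T := fun i => ExistsEqual.logIter (r - i) n) hT0 hT r le_rfl
  simp only [Nat.sub_self, Nat.sub_zero] at hT0 hTn
  change _ ≤ (n : ℝ) at hTn
  have hnR : (1 : ℝ) ≤ n := by exact_mod_cast hn
  by_contra hsend
  have hshort : ∀ k : ℕ, min γ (1 / (N : ℝ) ^ 2) * (n * ExistsEqual.logIter r (n : ℝ)) ≤ k →
      P.IsShort r k := by
    intro k hk
    have hlt : ∀ x y, ∀ w ∈ P.transcript first x y, w.length < k := by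
      intro x y w hw
      by_contra! hc
      exact hsend ⟨x, y, w, hw, hk.trans (by exact_mod_cast hc)⟩
    intro a b
    cases first with
    | alice => exact ⟨hround a b, hlt a b⟩
    | bob => exact ⟨hround b a, hlt b a⟩
  rcases lt_or_ge n N with hlt | hge
  · have hP := hshort 1 (by
      have h1 : (n : ℝ) ≤ N := by exact_mod_cast hlt.le
      calc min γ (1 / (N : ℝ) ^ 2) * (n * ExistsEqual.logIter r (n : ℝ))
          ≤ 1 / (N : ℝ) ^ 2 * (N * N) := by
            gcongr
            · exact min_le_right _ _
            · exact hTn.trans h1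
        _ = 1 := by field_simp
        _ ≤ ((1 : ℕ) : ℝ) := by norm_num)
    have := ExistsEqual.unifError_ge_of_isShort_one hn le_rfl (by omega) hP
    linarith
  · have hgeR : (N : ℝ) ≤ n := by exact_mod_cast hge
    have hP := hshort ⌈min γ (1 / (N : ℝ) ^ 2) * (n * ExistsEqual.logIter r (n : ℝ))⌉₊
      (Nat.le_ceil _)
    have hs0 : 0 ≤ min γ (1 / (N : ℝ) ^ 2) * (n * ExistsEqual.logIter r (n : ℝ)) := by positivity
    have hs : min γ (1 / (N : ℝ) ^ 2) * (n * ExistsEqual.logIter r (n : ℝ)) ≤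
        γ * (n * ExistsEqual.logIter r (n : ℝ)) := by
      gcongr
      exact min_le_left _ _
    have h1 : 1 ≤ γ * (n * ExistsEqual.logIter r (n : ℝ)) := by
      have h2 : 1 ≤ γ * n := by
        rw [← div_le_iff₀' hγ]
        linarith
      nlinarith
    have := hmain n hn (by linarith) r _ hr (by
      have := (Nat.ceil_lt_add_one hs0).le
      linarith) P hP
    linarith
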